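/- **Setting.** Let $d\ge 1$, let $\Omega\subset\mathbb{R}^d$ be compact and convex with non-empty interior $\Omega^\circ$, and let $p_0,p_1$ be probability densities on $\Omega$ (with respect to Lebesgue measure) that are continuous on $\Omega$ and bounded away from zero there. For $z\in\Omega^\circ$ and $t\in[0,1]$ put $S_t(z)=\{\delta\in\mathbb{R}^d:\ z-t\delta\in\Omega,\ z+(1-t)\delta\in\Omega\}$ and $$v(t,z)=\mathbb{E}[X_1-X_0\mid (1-t)X_0+tX_1=z]=\frac{\int_{S_t(z)}\delta\,p_0(z-t\delta)\,p_1(z+(1-t)\delta)\,d\delta}{\int_{S_t(z)}p_0(z-t\delta)\,p_1(z+(1-t)\delta)\,d\delta},$$ where $X_0\sim p_0$ and $X_1\sim p_1$ are independent. For $\eta\ge 0$ put $$\omega(\eta)=\sup_{z,z'\in\Omega,\ \|z-z'\|\le\eta}\max\left\{\left|\frac{p_0(z)}{p_0(z')}-1\right|,\left|\frac{p_1(z)}{p_1(z')}-1\right|\right\},\qquad \omega^{-1}(1)=\sup\{\eta\in[0,\mathrm{diam}(\Omega)]:\ \omega(\eta)\le 1\}.$$ Let $\Psi:(0,\infty)\to\mathbb{R}$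 be any antiderivative of $u\mapsto 1/(u+\omega(u))$ and assume the Osgood condition $\Psi(u)\to-\infty$ as $u\downarrow 0$. (Then $\Psi$ is a bijection onto $\mathbb{R}$ with inverse $\Psi^{-1}$; at $\eta=0$ the right-hand sides of the bounds (1) and (2) below are read as $0$, their limit as $\eta\downarrow0$.) For $x\in\Omega^\circ$ let $t\mapsto\mathfrak{R}(t,x)$ be the unique solution of $$\mathfrak{R}(t,x)=x+\int_0^t v(s,\mathfrak{R}(s,x))\,ds,\qquad t\in[0,1],$$ with $\mathfrak{R}(t,x)\in\Omega^\circ$ for $t\in[0,1)$. For $\varepsilon,\gamma>0$ put $\Omega^{-\varepsilon}=\{x:\ \overline{B}(x,\varepsilon)\subseteq\Omega\}$, with $\overline{B}(x,\varepsilon)$ the closed Euclidean ball, and $\mathcal{A}_\gamma=\{x\in\Omega:\ \mathrm{dist}(\mathfrak{R}(1,x),\partial\Omega)\le\gamma\}$. **Theorem.** Such a solution $\mathfrak{R}(\cdot,x)$ exists and is unique for every $x\in\Omega^\circ$. There are constants $\mathfrak{C}_1,\mathfrak{C}_2>0$ and $\mathfrak{K}_1,\mathfrak{K}_2,\mathfrak{K}_3>0$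 that depend only on $d$, $\mathrm{diam}(\Omega)$ and $\omega^{-1}(1)$ such that for every $\varepsilon>0$: (i) $x\mapsto\mathfrak{R}(t,x)$ is uniformly continuous on $\Omega^{-\varepsilon}$, uniformly in $t\in[0,1]$. Indeed, for all $\eta\ge0$, all $t\in[0,1]$ and all $x,x'\in\Omega^{-\varepsilon}$ with $\|x-x'\|\le\eta$, $$\|\mathfrak{R}(t,x)-\mathfrak{R}(t,x')\|\le\Psi^{-1}\!\left(\frac{\Psi(\eta)}{2}+\mathfrak{C}_1+\frac{\mathfrak{C}_2}{\varepsilon}\ln\frac{\mathrm{diam}(\Omega)}{\varepsilon}\right)+\mathrm{diam}(\Omega)\max\left\{\frac{4\mathfrak{C}_2}{2\mathfrak{C}_2-\varepsilon\Psi(\eta)},\ \frac{\eta}{\Psi^{-1}(-2\mathfrak{C}_2/\varepsilon)}\right\}.\tag{1}$$ (If $2\mathfrak{C}_2=\varepsilon\Psi(\eta)$, the first entry of the maximum is omitted.) (ii) For all $\gamma\in(0,\mathrm{diam}(\Omega)/2]$, $\eta\ge0$, $t\in[0,1]$ and $x,x'\in\Omega^{-\varepsilon}\setminus\mathcal{A}_\gamma$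 with $\|x-x'\|\le\eta$, $$\|\mathfrak{R}(t,x)-\mathfrak{R}(t,x')\|\le\Psi^{-1}\big(\Psi(\eta)+Q\big),\qquad Q=\mathfrak{K}_1+\frac{\mathfrak{K}_2}{\min\{\varepsilon,\gamma\}}\ln\frac{\mathrm{diam}(\Omega)}{\varepsilon}+\frac{\mathfrak{K}_3}{\varepsilon\gamma}.\tag{2}$$ If moreover $\omega(\eta)\le L\eta$ for all $\eta\ge0$ with some $L\ge0$, then $\|\mathfrak{R}(t,x)-\mathfrak{R}(t,x')\|\le e^{(1+L)Q}\|x-x'\|$ for all $t\in[0,1]$ and $x,x'\in\Omega^{-\varepsilon}\setminus\mathcal{A}_\gamma$. In particular, if $p_0$ and $p_1$ are Lipschitz on $\Omega$, then $x\mapsto\mathfrak{R}(t,x)$ is Lipschitz on $\Omega^{-\varepsilon}\setminus\mathcal{A}_\gamma$, with a constant that does not depend on $t$. -/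

import Mathlib

open Set Filter Topology MeasureTheory

noncomputable section

namespace RectifiedFlow

/-- Euclidean space `ℝ^d`. -/
abbrev E (d : ℕ) : Type := EuclideanSpace ℝ (Fin d)

variable {d : ℕ}

/-- `A^{-ε}`: the points whose closed `ε`-ball is contained in `A`. -/
def erosion (A : Set (E d)) (ε : ℝ) : Set (E d) :=
  {x | Metric.closedBall x ε ⊆ A}

/-- `p` (restricted to `Ω`) is a probability density with respect to Lebesgue measure on `Ω`
that is continuous on `Ω` and bounded away from zero on `Ω`. Values of `p` off `Ω` are never used.
(For compact `Ω`, boundedness from above is automatic.) -/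
structure IsRegularDensity (Ω : Set (E d)) (p : E d → ℝ) : Prop where
  continuousOn : ContinuousOn p Ω
  bounded_below : ∃ c : ℝ, 0 < c ∧ ∀ x ∈ Ω, c ≤ p x
  integral_eq_one : ∫ x in Ω, p x = 1

/-- `S_t(z)`: the displacements `δ = x₁ - x₀` with `x₀, x₁ ∈ Ω` and `(1 - t) x₀ + t x₁ = z`. -/
def displacements (Ω : Set (E d)) (t : ℝ) (z : E d) : Set (E d) :=
  {δ | z - t • δ ∈ Ω ∧ z + (1 - t) • δ ∈ Ω}

/-- The velocity field `v(t, z) = E[X₁ - X₀ | (1 - t) X₀ + t X₁ = z]` for independent `X₀`, `X₁`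
with densities `p₀`, `p₁` on `Ω`: the mean of `δ` under the conditional density of `X₁ - X₀`
given `X_t = z`, which is proportional to `p₀(z - tδ) p₁(z + (1-t)δ)` on `S_t(z)`. -/
def velocity (Ω : Set (E d)) (p₀ p₁ : E d → ℝ) (t : ℝ) (z : E d) : E d :=
  (∫ δ in displacements Ω t z, p₀ (z - t • δ) * p₁ (z + (1 - t) • δ))⁻¹ •
    ∫ δ in displacements Ω t z, (p₀ (z - t • δ) * p₁ (z + (1 - t) • δ)) • δ

/-- `z` is a Carathéodory solution on `[0, 1]` of `z' = v(t, z)`, `z(0) = x`. As `v` is only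
considered on the interior of `Ω`, the path has to lie there for all times `t < 1`. -/
structure IsRectifiedPath (Ω : Set (E d)) (p₀ p₁ : E d → ℝ) (x : E d) (z : ℝ → E d) : Prop where
  mem_interior : ∀ t ∈ Ico (0 : ℝ) 1, z t ∈ interior Ω
  integrable : IntervalIntegrable (fun s => velocity Ω p₀ p₁ s (z s)) volume 0 1
  integral_eq : ∀ t ∈ Icc (0 : ℝ) 1, z t = x + ∫ s in (0 : ℝ)..t, velocity Ω p₀ p₁ s (z s)

/-- The rectified flow `ℜ(t, x)`: the position at time `t` of the solution started at `x`. -/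
def rectifiedFlow (Ω : Set (E d)) (p₀ p₁ : E d → ℝ) (t : ℝ) (x : E d) : E d :=
  Classical.epsilon (IsRectifiedPath Ω p₀ p₁ x) t

/-- `ω(η)`: the joint modulus of relative continuity of the two densities. -/
def omega (Ω : Set (E d)) (p₀ p₁ : E d → ℝ) (η : ℝ) : ℝ :=
  sSup {r | ∃ z ∈ Ω, ∃ z' ∈ Ω, ‖z - z'‖ ≤ η ∧
    r = max |p₀ z / p₀ z' - 1| |p₁ z / p₁ z' - 1|}

/-- `ω⁻¹(1)`: the generalized inverse at `1` of `ω` on `[0, diam Ω]`. -/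
def omegaInvOne (Ω : Set (E d)) (p₀ p₁ : E d → ℝ) : ℝ :=
  sSup {η | η ∈ Icc 0 (Metric.diam Ω) ∧ omega Ω p₀ p₁ η ≤ 1}

/-- `Ψ(u) = ∫ du / (u + ω(u))`, the antiderivative on `(0, ∞)` that vanishes at `a`. -/
def Psi (Ω : Set (E d)) (p₀ p₁ : E d → ℝ) (a u : ℝ) : ℝ :=
  ∫ s in a..u, (s + omega Ω p₀ p₁ s)⁻¹

/-- The inverse of `Ψ : (0, ∞) → ℝ`. -/
def PsiInv (Ω : Set (E d)) (p₀ p₁ : E d → ℝ) (a y : ℝ) : ℝ :=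
  Function.invFunOn (Psi Ω p₀ p₁ a) (Ioi 0) y

/-- `𝒜_γ`: the starting points whose final position is within `γ` of the boundary. -/
def nearBoundary (Ω : Set (E d)) (p₀ p₁ : E d → ℝ) (γ : ℝ) : Set (E d) :=
  {x ∈ Ω | Metric.infDist (rectifiedFlow Ω p₀ p₁ 1 x) (frontier Ω) ≤ γ}

/-- The modulus of continuity of the flow on `Ω^{-ε}`. At `η = 0`, where `Ψ(0) = -∞`,
it is read as its limit `0`. -/
def globalModulus (Ω : Set (E d)) (p₀ p₁ : E d → ℝ) (a C₁ C₂ ε η : ℝ) : ℝ :=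
  open Classical in
  if η = 0 then 0 else
    PsiInv Ω p₀ p₁ a
        (Psi Ω p₀ p₁ a η / 2 + C₁ + C₂ / ε * Real.log (Metric.diam Ω / ε)) +
      Metric.diam Ω *
        max (4 * C₂ / (2 * C₂ - ε * Psi Ω p₀ p₁ a η)) (η / PsiInv Ω p₀ p₁ a (-2 * C₂ / ε))

/-- The exponent `C₁ + C₂ / min(ε, γ) * ln(diam Ω / ε) + C₃ / (ε γ)`. -/
def awayExponent (Ω : Set (E d)) (C₁ C₂ C₃ ε γ : ℝ) : ℝ :=
  C₁ + C₂ / min ε γ * Real.log (Metric.diam Ω / ε) + C₃ / (ε * γ)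

/-- The modulus of continuity of the flow on `Ω^{-ε} \ 𝒜_γ`. At `η = 0`, where `Ψ(0) = -∞`,
it is read as its limit `0`. -/
def awayModulus (Ω : Set (E d)) (p₀ p₁ : E d → ℝ) (a C₁ C₂ C₃ ε γ η : ℝ) : ℝ :=
  open Classical in
  if η = 0 then 0 else
    PsiInv Ω p₀ p₁ a (Psi Ω p₀ p₁ a η + awayExponent Ω C₁ C₂ C₃ ε γ)

end RectifiedFlow

end

noncomputable section

namespace RectifiedFlow

variable {d : ℕ} {Ω : Set (E d)} {p₀ p₁ : E d → ℝ}

/-! The velocity `v(t, z)` is the mean of `δ` over the compact convex set `S_t(z)` with weight `p₀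
p₁`, so it changes with `z` for two reasons. The weight changes by a relative error of order `ω(‖z -
z'‖)`. The set changes because, when the `ρ`-balls around `z` and `z'` lie in `Ω`, each of `S_t(z)`,
`S_t(z')` lies in the dilate of the other by the factor `1 + ‖z - z'‖ / ρ`; this costs a volume
fraction of order `‖z - z'‖ / ρ`. Density ratios on `Ω` are bounded in terms of `diam Ω` and
`ω⁻¹(1)` by chaining. Hence `v` has the modulus `A (1 + 1/ρ) (h + ω(h))` at distance `ρ` from the
boundary (`norm_velocity_sub_le`), and Osgood's inequality (`le_of_osgood`) turns this into `Ψ(‖z -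
z'‖) ≤ Ψ(η) + A (1 + 1/ρ)` for two paths at that distance.

The distance of a path from the boundary is controlled through `m = E[X₁ | X_t = z]`, which lies in
`Ω`: since `(z / (1 - t))' = m / (1 - t)²`, the point `z(t)` is `(1 - t) x + t y` with `y` a
weighted mean of points of `Ω`. So `z(t)` keeps at least the distance `(1 - t) ε` when `x` starts at
distance `ε` (`closedBall_path_subset`).

For the bound on `Ω^{-ε}`, Osgood is used up to time `1 - τ` with `ρ = τ ε`, and the remaining
motion of the two paths costs at most `2 diam(Ω) τ`, as the speed is at most `diam Ω`; then `τ` is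
optimized in terms of `Ψ(η)`. For starting points outside `𝒜_γ` the end point is at distance `γ`
from the boundary, and the speed bound shows that the whole path keeps the distance `γ ε / (2 diam
Ω)`, so that Osgood applies on all of `[0, 1]`. The logarithmic terms of the statement are
nonnegative and are not needed by this argument.

Existence comes from Picard iteration of the identity for `z / (1 - t)`, which preserves the
distance to the boundary; the iterates converge because their differences have majorants that
Osgood's condition forces to zero. Uniqueness is stability with equal starting points. -/

/-- The standing assumptions on the domain and the two densities. -/
structure Admissible (Ω : Set (E d)) (p₀ p₁ : E d → ℝ) : Prop where
  compact : IsCompact Ω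
  convex : Convex ℝ Ω
  nonempty : (interior Ω).Nonempty
  left : IsRegularDensity Ω p₀
  right : IsRegularDensity Ω p₁

/-! ### The modulus of relative continuity -/

lemma IsRegularDensity.pos {p : E d → ℝ} (hp : IsRegularDensity Ω p) {x : E d} (hx : x ∈ Ω) :
    0 < p x := by
  obtain ⟨c, hc, h⟩ := hp.bounded_below
  exact hc.trans_le (h x hx)

lemma IsRegularDensity.bounded_above {p : E d → ℝ} (hp : IsRegularDensity Ω p)
    (hΩ : IsCompact Ω) : ∃ M : ℝ, 0 < M ∧ ∀ x ∈ Ω, p x ≤ M := by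
  obtain ⟨M, hM⟩ := hΩ.exists_bound_of_continuousOn hp.continuousOn
  exact ⟨max M 1, by positivity, fun x hx =>
    ((le_abs_self _).trans (hM x hx)).trans (le_max_left _ _)⟩

lemma IsRegularDensity.ratio_bounded {p : E d → ℝ} (hp : IsRegularDensity Ω p)
    (hΩ : IsCompact Ω) : ∃ B : ℝ, 0 ≤ B ∧ ∀ x ∈ Ω, ∀ y ∈ Ω, |p x / p y - 1| ≤ B := by
  obtain ⟨M, hM, hpM⟩ := hp.bounded_above hΩ
  obtain ⟨c, hc, hpc⟩ := hp.bounded_below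
  refine ⟨M / c + 1, by positivity, fun x hx y hy => ?_⟩
  have h1 : 0 ≤ p x / p y := (div_pos (hp.pos hx) (hp.pos hy)).le
  have h2 : p x / p y ≤ M / c := by
    have := hpM x hx
    have := hpc y hy
    gcongr
  rw [abs_le]
  constructor <;> linarith [div_pos hM hc]

lemma IsRegularDensity.ratio_uniform {p : E d → ℝ} (hp : IsRegularDensity Ω p)
    (hΩ : IsCompact Ω) {e : ℝ} (he : 0 < e) :
    ∃ η > 0, ∀ x ∈ Ω, ∀ y ∈ Ω, ‖x - y‖ ≤ η → |p x / p y - 1| ≤ e := by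
  obtain ⟨c, hc, hpc⟩ := hp.bounded_below
  have hu := hΩ.uniformContinuousOn_of_continuous hp.continuousOn
  rw [Metric.uniformContinuousOn_iff] at hu
  obtain ⟨η, hη, h⟩ := hu (e * c) (by positivity)
  refine ⟨η / 2, by positivity, fun x hx y hy hxy => ?_⟩
  have h1 := h x hx y hy (by rw [dist_eq_norm]; linarith)
  have hy0 := hp.pos hy
  rw [Real.dist_eq] at h1
  rw [div_sub_one hy0.ne', abs_div, abs_of_pos hy0, div_le_iff₀ hy0]
  nlinarith [hpc y hy]

namespace Admissible

variable (H : Admissible Ω p₀ p₁)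
include H

lemma exists_omega_bound : ∃ B : ℝ, 0 ≤ B ∧ ∀ x ∈ Ω, ∀ y ∈ Ω,
    max |p₀ x / p₀ y - 1| |p₁ x / p₁ y - 1| ≤ B := by
  obtain ⟨B, hB, h⟩ := H.left.ratio_bounded H.compact
  obtain ⟨B', hB', h'⟩ := H.right.ratio_bounded H.compact
  exact ⟨max B B', le_max_of_le_left hB, fun x hx y hy =>
    max_le_max (h x hx y hy) (h' x hx y hy)⟩

lemma max_le_omega {x y : E d} {η : ℝ} (hx : x ∈ Ω) (hy : y ∈ Ω) (hxy : ‖x - y‖ ≤ η) :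
    max |p₀ x / p₀ y - 1| |p₁ x / p₁ y - 1| ≤ omega Ω p₀ p₁ η := by
  obtain ⟨B, -, h⟩ := H.exists_omega_bound
  refine le_csSup ⟨B, ?_⟩ ⟨x, hx, y, hy, hxy, rfl⟩
  rintro _ ⟨z, hz, z', hz', -, rfl⟩
  exact h z hz z' hz'

omit H in
lemma omega_le {B η : ℝ} (hB : 0 ≤ B) (h : ∀ x ∈ Ω, ∀ y ∈ Ω, ‖x - y‖ ≤ η →
    max |p₀ x / p₀ y - 1| |p₁ x / p₁ y - 1| ≤ B) : omega Ω p₀ p₁ η ≤ B := by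
  refine Real.sSup_le ?_ hB
  rintro _ ⟨z, hz, z', hz', hzz, rfl⟩
  exact h z hz z' hz' hzz

omit H in
lemma omega_nonneg (η : ℝ) : 0 ≤ omega Ω p₀ p₁ η := by
  refine Real.sSup_nonneg ?_
  rintro _ ⟨z, hz, z', hz', hzz, rfl⟩
  positivity

lemma omega_mono : Monotone (omega Ω p₀ p₁) := fun _ _ h =>
  omega_le (omega_nonneg _) fun _ hx _ hy hxy => H.max_le_omega hx hy (hxy.trans h)

lemma omega_bounded : ∃ B : ℝ, 0 ≤ B ∧ ∀ η, omega Ω p₀ p₁ η ≤ B := by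
  obtain ⟨B, hB, h⟩ := H.exists_omega_bound
  exact ⟨B, hB, fun η => omega_le hB fun x hx y hy _ => h x hx y hy⟩

omit H in
lemma abs_mul_sub_one_le {a b u v : ℝ} (ha : |a - 1| ≤ u) (hb : |b - 1| ≤ v) :
    |a * b - 1| ≤ u + v + u * v := by
  have h : a * b - 1 = (a - 1) + (b - 1) + (a - 1) * (b - 1) := by ring
  rw [h]
  calc _ ≤ |a - 1| + |b - 1| + |(a - 1) * (b - 1)| := abs_add_three _ _ _
    _ ≤ u + v + u * v := by
      rw [abs_mul]
      have := (abs_nonneg (a - 1)).trans ha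
      gcongr

/-- Convexity gives a point of the segment `[x, y]` within `u` of `x` and `v` of `y`, and density
ratios multiply along the way. Equivalently, `1 + ω` is submultiplicative. -/
lemma omega_add {u v : ℝ} (hu : 0 ≤ u) (hv : 0 ≤ v) :
    omega Ω p₀ p₁ (u + v) ≤
      omega Ω p₀ p₁ u + omega Ω p₀ p₁ v + omega Ω p₀ p₁ u * omega Ω p₀ p₁ v := by
  have hu' := omega_nonneg (Ω := Ω) (p₀ := p₀) (p₁ := p₁) u
  have hv' := omega_nonneg (Ω := Ω) (p₀ := p₀) (p₁ := p₁) v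
  refine omega_le (by positivity) fun x hx y hy hxy => ?_
  -- The intermediate point divides by `u + v`, so `u = v = 0` is separate.
  rcases (add_nonneg hu hv).eq_or_lt with h0 | h0
  · have hu0 : u = 0 := by linarith
    have hv0 : v = 0 := by linarith
    have := H.max_le_omega hx hy (hxy.trans_eq (by rw [hu0, hv0, add_zero] : u + v = u))
    nlinarith
  obtain ⟨z, hz, hxz, hzy⟩ : ∃ z ∈ Ω, ‖x - z‖ ≤ u ∧ ‖z - y‖ ≤ v := by
    refine ⟨(v / (u + v)) • x + (u / (u + v)) • y, H.convex hx hy (by positivity) (by positivity)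
      (by field_simp; ring), ?_, ?_⟩
    · have h1 : x - ((v / (u + v)) • x + (u / (u + v)) • y) = (u / (u + v)) • (x - y) := by
        have : v / (u + v) = 1 - u / (u + v) := by field_simp; ring
        rw [this]; module
      rw [h1, norm_smul, Real.norm_of_nonneg (by positivity)]
      calc _ ≤ u / (u + v) * (u + v) := by gcongr
        _ = u := by field_simp
    · have h1 : (v / (u + v)) • x + (u / (u + v)) • y - y = (v / (u + v)) • (x - y) := by
        have : u / (u + v) = 1 - v / (u + v) := by field_simp; ring
        rw [this]; module
      rw [h1, norm_smul, Real.norm_of_nonneg (by positivity)]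
      calc _ ≤ v / (u + v) * (u + v) := by gcongr
        _ = v := by field_simp
  have h1 := H.max_le_omega hx hz hxz
  have h2 := H.max_le_omega hz hy hzy
  have e0 : p₀ x / p₀ y = p₀ x / p₀ z * (p₀ z / p₀ y) := by
    have := (H.left.pos hz).ne'
    have := (H.left.pos hy).ne'
    field_simp
  have e1 : p₁ x / p₁ y = p₁ x / p₁ z * (p₁ z / p₁ y) := by
    have := (H.right.pos hz).ne'
    have := (H.right.pos hy).ne'
    field_simp
  rw [e0, e1]
  exact max_le
    (abs_mul_sub_one_le ((le_max_left _ _).trans h1) ((le_max_left _ _).trans h2))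
    (abs_mul_sub_one_le ((le_max_right _ _).trans h1) ((le_max_right _ _).trans h2))

omit H in
lemma omega_of_neg {u : ℝ} (hu : u < 0) : omega Ω p₀ p₁ u = 0 :=
  le_antisymm (omega_le le_rfl fun _ _ _ _ hxy =>
    absurd (norm_nonneg _) (not_le.2 (hxy.trans_lt hu))) (omega_nonneg _)

lemma exists_omega_le {e : ℝ} (he : 0 < e) : ∃ η > 0, omega Ω p₀ p₁ η ≤ e := by
  obtain ⟨η, hη, h⟩ := H.left.ratio_uniform H.compact he
  obtain ⟨η', hη', h'⟩ := H.right.ratio_uniform H.compact he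
  exact ⟨min η η', lt_min hη hη', omega_le he.le fun x hx y hy hxy =>
    max_le (h x hx y hy (hxy.trans (min_le_left _ _))) (h' x hx y hy (hxy.trans (min_le_right _ _)))⟩

/-- By `omega_add`, increments of `ω` are bounded by `(1 + B) ω(v - u)`, and `ω` is small near `0`
by uniform continuity of the densities. Continuity makes `Ψ` differentiable with the expected
derivative. -/
lemma omega_continuous : Continuous (omega Ω p₀ p₁) := by
  obtain ⟨B, hB, hωB⟩ := H.omega_bounded
  have key : ∀ u v, u ≤ v → omega Ω p₀ p₁ v - omega Ω p₀ p₁ u ≤ (1 + B) * omega Ω p₀ p₁ (v - u) := by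
    intro u v huv
    have h0 := omega_nonneg (Ω := Ω) (p₀ := p₀) (p₁ := p₁) (v - u)
    rcases lt_or_ge u 0 with hu | hu
    · rw [omega_of_neg hu]
      nlinarith [H.omega_mono (by linarith : v ≤ v - u)]
    · have := H.omega_add hu (sub_nonneg.2 huv)
      rw [add_sub_cancel] at this
      nlinarith [hωB u]
  rw [Metric.continuous_iff]
  intro u e he
  obtain ⟨η, hη, h⟩ := H.exists_omega_le (e := e / (2 * (1 + B))) (by positivity)
  refine ⟨η, hη, fun v hv => ?_⟩
  rw [Real.dist_eq] at hv ⊢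
  have hb : (1 + B) * omega Ω p₀ p₁ η < e := by
    calc _ ≤ (1 + B) * (e / (2 * (1 + B))) := by gcongr
      _ = e / 2 := by field_simp
      _ < e := by linarith
  rw [abs_lt] at hv
  rcases le_total u v with huv | huv
  · rw [abs_of_nonneg (sub_nonneg.2 (H.omega_mono huv))]
    have := H.omega_mono (by linarith : v - u ≤ η)
    nlinarith [key u v huv]
  · rw [abs_sub_comm, abs_of_nonneg (sub_nonneg.2 (H.omega_mono huv))]
    have := H.omega_mono (by linarith : u - v ≤ η)
    nlinarith [key v u huv]

lemma diam_pos (hd : 1 ≤ d) : 0 < Metric.diam Ω := by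
  obtain ⟨x, hx⟩ := H.nonempty
  obtain ⟨r, hr, hball⟩ := Metric.isOpen_iff.1 isOpen_interior x hx
  have : Nontrivial (E d) := by
    have : Nonempty (Fin d) := ⟨⟨0, hd⟩⟩
    infer_instance
  obtain ⟨v, hv⟩ := exists_ne (0 : E d)
  have hy : x + (r / 2 / ‖v‖) • v ∈ Ω := interior_subset (hball (by
    have := norm_pos_iff.2 hv
    rw [Metric.mem_ball, dist_self_add_left, norm_smul, Real.norm_of_nonneg (by positivity),
      div_mul_cancel₀ _ this.ne']
    linarith))
  refine lt_of_lt_of_le ?_ (Metric.dist_le_diam_of_mem H.compact.isBounded hy (interior_subset hx))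
  rw [dist_pos]
  have := norm_pos_iff.2 hv
  simp [hv, hr.ne']

lemma omegaInvOne_pos (hd : 1 ≤ d) : 0 < omegaInvOne Ω p₀ p₁ := by
  obtain ⟨η, hη, h⟩ := H.exists_omega_le one_pos
  have hD := H.diam_pos hd
  refine lt_of_lt_of_le (lt_min hη hD) (le_csSup ⟨Metric.diam Ω, fun _ h => h.1.2⟩ ?_)
  exact ⟨⟨(lt_min hη hD).le, min_le_right _ _⟩, (H.omega_mono (min_le_left _ _)).trans h⟩

/-- The supremum defining `ω⁻¹(1)` is not shown to be attained; half of it lies strictly below some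
admissible `η`, which is enough for chaining. -/
lemma omega_half_le (hd : 1 ≤ d) : omega Ω p₀ p₁ (omegaInvOne Ω p₀ p₁ / 2) ≤ 1 := by
  have hw := H.omegaInvOne_pos hd
  have hne : {η | η ∈ Icc 0 (Metric.diam Ω) ∧ omega Ω p₀ p₁ η ≤ 1}.Nonempty := by
    by_contra h
    rw [not_nonempty_iff_eq_empty] at h
    rw [omegaInvOne, h, Real.sSup_empty] at hw
    exact hw.false
  obtain ⟨η, hη, h⟩ := exists_lt_of_lt_csSup hne (half_lt_self hw)
  exact (H.omega_mono h.le).trans hη.2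

/-- Along a chain of steps of length `ω⁻¹(1) / 2` the densities change at most by powers of `2`. -/
lemma one_add_omega_diam_le (hd : 1 ≤ d) :
    1 + omega Ω p₀ p₁ (Metric.diam Ω) ≤ 2 ^ ⌈2 * Metric.diam Ω / omegaInvOne Ω p₀ p₁⌉₊ := by
  have hw := H.omegaInvOne_pos hd
  set w := omegaInvOne Ω p₀ p₁
  -- Submultiplicativity of `1 + ω`, with `1 + ω(w / 2) ≤ 2` for each step.
  have key : ∀ k : ℕ, 1 + omega Ω p₀ p₁ (k * (w / 2)) ≤ 2 ^ k := by
    intro k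
    induction k with
    | zero =>
      have : omega Ω p₀ p₁ 0 ≤ 0 := omega_le le_rfl fun x hx y hy hxy => by
        obtain rfl : x = y := by
          simpa [sub_eq_zero] using hxy
        rw [div_self (H.left.pos hx).ne', div_self (H.right.pos hx).ne']
        simp
      simpa using this
    | succ k ih =>
      have h1 := H.omega_add (u := k * (w / 2)) (v := w / 2) (by positivity) (by positivity)
      have h2 := H.omega_half_le hd
      have h3 := omega_nonneg (Ω := Ω) (p₀ := p₀) (p₁ := p₁) (k * (w / 2))
      have h4 : ((k + 1 : ℕ) : ℝ) * (w / 2) = k * (w / 2) + w / 2 := by push_cast; ring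
      rw [h4, pow_succ]
      nlinarith
  refine le_trans ?_ (key _)
  gcongr
  apply H.omega_mono
  have := Nat.le_ceil (2 * Metric.diam Ω / w)
  calc Metric.diam Ω = 2 * Metric.diam Ω / w * (w / 2) := by field_simp
    _ ≤ _ := by gcongr

/-- This is where the constants come to depend on the densities through `ω⁻¹(1)` only. -/
lemma density_le (hd : 1 ≤ d) {x y : E d} (hx : x ∈ Ω) (hy : y ∈ Ω) :
    p₀ x ≤ 2 ^ ⌈2 * Metric.diam Ω / omegaInvOne Ω p₀ p₁⌉₊ * p₀ y ∧
      p₁ x ≤ 2 ^ ⌈2 * Metric.diam Ω / omegaInvOne Ω p₀ p₁⌉₊ * p₁ y := by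
  have h1 := H.one_add_omega_diam_le hd
  have h2 := H.max_le_omega hx hy
    ((dist_eq_norm x y).symm.trans_le (Metric.dist_le_diam_of_mem H.compact.isBounded hx hy))
  constructor
  · rw [← div_le_iff₀ (H.left.pos hy)]
    linarith [(le_abs_self _).trans ((le_max_left _ _).trans h2)]
  · rw [← div_le_iff₀ (H.right.pos hy)]
    linarith [(le_abs_self _).trans ((le_max_right _ _).trans h2)]

/-! ### The function `Ψ` and the Osgood inequality -/

lemma continuous_add_omega : Continuous fun s => s + omega Ω p₀ p₁ s :=
  continuous_id.add H.omega_continuous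

omit H in
lemma add_omega_pos {s : ℝ} (hs : 0 < s) : 0 < s + omega Ω p₀ p₁ s :=
  add_pos_of_pos_of_nonneg hs (omega_nonneg s)

lemma add_omega_mono : Monotone fun s => s + omega Ω p₀ p₁ s :=
  monotone_id.add H.omega_mono

lemma continuousOn_inv_add_omega : ContinuousOn (fun s => (s + omega Ω p₀ p₁ s)⁻¹) (Ioi 0) :=
  H.continuous_add_omega.continuousOn.inv₀ fun _ hs => (add_omega_pos hs).ne'

lemma intervalIntegrable_inv_add_omega {a b : ℝ} (ha : 0 < a) (hb : 0 < b) :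
    IntervalIntegrable (fun s => (s + omega Ω p₀ p₁ s)⁻¹) volume a b :=
  (H.continuousOn_inv_add_omega.mono fun _ hs => (lt_min ha hb).trans_le hs.1).intervalIntegrable

lemma hasDerivAt_Psi {a u : ℝ} (ha : 0 < a) (hu : 0 < u) :
    HasDerivAt (Psi Ω p₀ p₁ a) (u + omega Ω p₀ p₁ u)⁻¹ u := by
  have hc := H.continuousOn_inv_add_omega
  exact intervalIntegral.integral_hasDerivAt_right (H.intervalIntegrable_inv_add_omega ha hu)
    (hc.stronglyMeasurableAtFilter isOpen_Ioi _ hu)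
    (hc.continuousAt (Ioi_mem_nhds hu))

lemma Psi_sub {a u v : ℝ} (ha : 0 < a) (hu : 0 < u) (hv : 0 < v) :
    Psi Ω p₀ p₁ a v - Psi Ω p₀ p₁ a u = ∫ s in u..v, (s + omega Ω p₀ p₁ s)⁻¹ :=
  intervalIntegral.integral_interval_sub_left (H.intervalIntegrable_inv_add_omega ha hv)
    (H.intervalIntegrable_inv_add_omega ha hu)

lemma continuousOn_Psi {a : ℝ} (ha : 0 < a) : ContinuousOn (Psi Ω p₀ p₁ a) (Ioi 0) :=
  fun _ hu => (H.hasDerivAt_Psi ha hu).continuousAt.continuousWithinAt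

lemma strictMonoOn_Psi {a : ℝ} (ha : 0 < a) : StrictMonoOn (Psi Ω p₀ p₁ a) (Ioi 0) := by
  refine strictMonoOn_of_deriv_pos (convex_Ioi 0) (H.continuousOn_Psi ha) fun u hu => ?_
  rw [interior_Ioi] at hu
  rw [(H.hasDerivAt_Psi ha hu).deriv]
  exact inv_pos.2 (add_omega_pos hu)

/-- Any linear bound of `u + ω(u)` bounds the increments of `Ψ` from below. -/
lemma log_div_le_Psi_sub {a u v L : ℝ} (ha : 0 < a) (hu : 0 < u) (huv : u ≤ v)
    (h : ∀ s ∈ Icc u v, s + omega Ω p₀ p₁ s ≤ L * s) :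
    Real.log (v / u) / L ≤ Psi Ω p₀ p₁ a v - Psi Ω p₀ p₁ a u := by
  have hv := hu.trans_le huv
  rw [H.Psi_sub ha hu hv, ← integral_inv_of_pos hu hv, ← intervalIntegral.integral_div]
  refine intervalIntegral.integral_mono_on huv ?_ (H.intervalIntegrable_inv_add_omega hu hv) ?_
  · refine ContinuousOn.intervalIntegrable ?_
    refine ContinuousOn.div_const (continuousOn_id.inv₀ ?_) _
    intro s hs
    exact ((lt_min hu hv).trans_le hs.1).ne'
  · intro s hs
    have hs0 : 0 < s := hu.trans_le hs.1
    rw [div_eq_mul_inv, ← mul_inv, mul_comm]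
    exact inv_anti₀ (add_omega_pos hs0) (h s hs)

lemma tendsto_Psi_atTop {a : ℝ} (ha : 0 < a) : Tendsto (Psi Ω p₀ p₁ a) atTop atTop := by
  obtain ⟨B, hB, hωB⟩ := H.omega_bounded
  have h1 : Tendsto (fun v => Real.log (v / 1) / (1 + B) + Psi Ω p₀ p₁ a 1) atTop atTop := by
    refine tendsto_atTop_add_const_right _ _ (Tendsto.atTop_div_const (by positivity) ?_)
    simpa using Real.tendsto_log_atTop
  refine tendsto_atTop_mono' _ ?_ h1
  filter_upwards [eventually_ge_atTop 1] with v hv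
  have := H.log_div_le_Psi_sub (L := 1 + B) ha one_pos hv fun s hs => by
    nlinarith [hωB s, hs.1]
  linarith

/-- `Ψ` is unbounded below by Osgood's condition and unbounded above because `ω` is bounded; the
rest is the intermediate value theorem. -/
lemma exists_Psi_eq {a : ℝ} (ha : 0 < a) (hO : Tendsto (Psi Ω p₀ p₁ a) (𝓝[>] 0) atBot) (y : ℝ) :
    ∃ u ∈ Ioi (0 : ℝ), Psi Ω p₀ p₁ a u = y := by
  obtain ⟨u, hu, hu0⟩ :=
    ((hO.eventually (eventually_le_atBot y)).and self_mem_nhdsWithin).exists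
  obtain ⟨v, hv, hv0⟩ :=
    (((H.tendsto_Psi_atTop ha).eventually (eventually_ge_atTop y)).and
      (eventually_gt_atTop 0)).exists
  obtain ⟨x, hx, hxy⟩ := isPreconnected_Ioi.intermediate_value hu0 hv0
    (H.continuousOn_Psi ha) ⟨hu, hv⟩
  exact ⟨x, hx, hxy⟩

lemma PsiInv_pos {a : ℝ} (ha : 0 < a) (hO : Tendsto (Psi Ω p₀ p₁ a) (𝓝[>] 0) atBot) (y : ℝ) :
    0 < PsiInv Ω p₀ p₁ a y :=
  Function.invFunOn_mem (H.exists_Psi_eq ha hO y)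

lemma Psi_PsiInv {a : ℝ} (ha : 0 < a) (hO : Tendsto (Psi Ω p₀ p₁ a) (𝓝[>] 0) atBot) (y : ℝ) :
    Psi Ω p₀ p₁ a (PsiInv Ω p₀ p₁ a y) = y :=
  Function.invFunOn_eq (H.exists_Psi_eq ha hO y)

/-- Osgood's inequality. -/
lemma le_of_osgood {a η K T r : ℝ} {h : ℝ → ℝ} (ha : 0 < a) (hη : 0 < η) (hK : 0 ≤ K)
    (hc : ContinuousOn h (Icc 0 T)) (h0 : ∀ t ∈ Icc 0 T, 0 ≤ h t)
    (hh : ∀ t ∈ Icc 0 T, h t ≤ η + K * ∫ s in (0 : ℝ)..t, (h s + omega Ω p₀ p₁ (h s)))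
    (hr : 0 < r) (hηr : Psi Ω p₀ p₁ a η + K * T ≤ Psi Ω p₀ p₁ a r) :
    ∀ t ∈ Icc 0 T, h t ≤ r := by
  intro t ht
  have hT : 0 ≤ T := ht.1.trans ht.2
  set G : ℝ → ℝ := fun t => η + K * ∫ s in (0 : ℝ)..t, (h s + omega Ω p₀ p₁ (h s)) with hG
  have hφ : ContinuousOn (fun s => h s + omega Ω p₀ p₁ (h s)) (Icc 0 T) :=
    H.continuous_add_omega.comp_continuousOn hc
  have hint : ∀ t ∈ Icc 0 T,
      IntervalIntegrable (fun s => h s + omega Ω p₀ p₁ (h s)) volume 0 t := fun t ht =>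
    (hφ.mono (by rw [uIcc_of_le ht.1]; exact Icc_subset_Icc_right ht.2)).intervalIntegrable
  have hGη : ∀ t ∈ Icc 0 T, η ≤ G t := by
    intro t ht
    have : 0 ≤ ∫ s in (0 : ℝ)..t, (h s + omega Ω p₀ p₁ (h s)) :=
      intervalIntegral.integral_nonneg ht.1 fun s hs =>
        add_nonneg (h0 s ⟨hs.1, hs.2.trans ht.2⟩) (omega_nonneg _)
    have := mul_nonneg hK this
    simp only [hG]
    linarith
  have hGc : ContinuousOn G (Icc 0 T) := by
    refine continuousOn_const.add (continuousOn_const.mul ?_)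
    have := intervalIntegral.continuousOn_primitive_interval (μ := volume) (a := 0) (b := T)
      (f := fun s => h s + omega Ω p₀ p₁ (h s)) (by
        rw [uIcc_of_le hT]; exact hφ.integrableOn_Icc)
    rwa [uIcc_of_le hT] at this
  -- Since `h ≤ G` and `s + ω(s)` is monotone, `G' = K (h + ω(h)) ≤ K (G + ω(G))`, that is, `Ψ(G)' ≤
  -- K`.
  have hanti : AntitoneOn (fun t => Psi Ω p₀ p₁ a (G t) - K * t) (Icc 0 T) := by
    refine antitoneOn_of_hasDerivWithinAt_nonpos (convex_Icc 0 T)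
      (f' := fun t => (G t + omega Ω p₀ p₁ (G t))⁻¹ * (K * (h t + omega Ω p₀ p₁ (h t))) - K)
      ?_ ?_ ?_
    · refine ContinuousOn.sub ?_ (by fun_prop)
      exact (H.continuousOn_Psi ha).comp hGc fun t ht => hη.trans_le (hGη t ht)
    · intro t ht
      rw [interior_Icc] at ht ⊢
      have ht' : t ∈ Icc 0 T := Ioo_subset_Icc_self ht
      have hd1 : HasDerivAt G (K * (h t + omega Ω p₀ p₁ (h t))) t := by
        refine HasDerivAt.const_add _ (HasDerivAt.const_mul _ ?_)
        exact intervalIntegral.integral_hasDerivAt_right (hint t ht')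
          ((hφ.mono Ioo_subset_Icc_self).stronglyMeasurableAtFilter isOpen_Ioo _ ht)
          (hφ.continuousAt (Icc_mem_nhds ht.1 ht.2))
      refine HasDerivAt.hasDerivWithinAt (HasDerivAt.sub ?_ ?_)
      · exact (H.hasDerivAt_Psi ha (hη.trans_le (hGη t ht'))).comp t hd1
      · simpa using (hasDerivAt_id t).const_mul K
    · intro t ht
      rw [interior_Icc] at ht
      have ht' : t ∈ Icc 0 T := Ioo_subset_Icc_self ht
      have h1 := H.add_omega_mono (hh t ht')
      have h2 := add_omega_pos (Ω := Ω) (p₀ := p₀) (p₁ := p₁) (hη.trans_le (hGη t ht'))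
      simp only at h1
      have h3 : (G t + omega Ω p₀ p₁ (G t))⁻¹ * (h t + omega Ω p₀ p₁ (h t)) ≤ 1 := by
        rw [inv_mul_le_iff₀ h2, mul_one]
        exact h1
      nlinarith
  have h1 := hanti (left_mem_Icc.2 hT) ht ht.1
  have h2 : G 0 = η := by simp [hG]
  simp only [h2, mul_zero, sub_zero] at h1
  have h3 : Psi Ω p₀ p₁ a (G t) ≤ Psi Ω p₀ p₁ a r := by
    have := mul_le_mul_of_nonneg_left ht.2 hK
    linarith
  exact (hh t ht).trans (((H.strictMonoOn_Psi ha).le_iff_le (hη.trans_le (hGη t ht)) hr).1 h3)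

end Admissible

open scoped Pointwise

/-! ### The sets of displacements -/

/-- A weighted mean of points of a closed convex set lies in this set. -/
lemma weighted_mean_mem {α : Type*} [MeasurableSpace α] {μ : Measure α} {K : Set (E d)}
    (hK : IsClosed K) (hconv : Convex ℝ K) {f : α → ℝ} {g : α → E d} (hf : Integrable f μ)
    (hfg : Integrable (fun x => f x • g x) μ) (hf0 : ∀ᵐ x ∂μ, 0 ≤ f x)
    (hg : ∀ᵐ x ∂μ, f x ≠ 0 → g x ∈ K) (hpos : 0 < ∫ x, f x ∂μ) :
    (∫ x, f x ∂μ)⁻¹ • ∫ x, f x • g x ∂μ ∈ K := by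
  -- Otherwise a linear functional strictly separates the mean from `K`; integrating the separation
  -- against the weight is contradictory.
  by_contra hp
  obtain ⟨l, u, hu, hl⟩ := geometric_hahn_banach_point_closed hconv hK hp
  rw [map_smul, ← l.integral_comp_comm hfg, smul_eq_mul, inv_mul_lt_iff₀ hpos,
    mul_comm, ← integral_const_mul] at hu
  refine absurd hu (not_lt.2 (integral_mono_ae (hf.const_mul u) (l.integrable_comp hfg) ?_))
  filter_upwards [hf0, hg] with x h0 hx
  rw [map_smul, smul_eq_mul, mul_comm]
  rcases eq_or_ne (f x) 0 with h | h
  · rw [h, zero_mul, zero_mul]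
  · exact mul_le_mul_of_nonneg_left (hl _ (hx h)).le h0

lemma isClosed_displacements (hΩ : IsClosed Ω) (t : ℝ) (z : E d) :
    IsClosed (displacements Ω t z) :=
  (hΩ.preimage (by fun_prop : Continuous fun δ : E d => z - t • δ)).inter
    (hΩ.preimage (by fun_prop : Continuous fun δ : E d => z + (1 - t) • δ))

lemma convex_displacements (hΩ : Convex ℝ Ω) (t : ℝ) (z : E d) :
    Convex ℝ (displacements Ω t z) := by
  intro x hx y hy a b ha hb hab
  have e1 : z - t • (a • x + b • y) = a • (z - t • x) + b • (z - t • y) := by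
    calc _ = (a + b) • z - t • (a • x + b • y) := by rw [hab, one_smul]
      _ = _ := by module
  have e2 : z + (1 - t) • (a • x + b • y) = a • (z + (1 - t) • x) + b • (z + (1 - t) • y) := by
    calc _ = (a + b) • z + (1 - t) • (a • x + b • y) := by rw [hab, one_smul]
      _ = _ := by module
  refine ⟨?_, ?_⟩
  · rw [e1]; exact hΩ hx.1 hy.1 ha hb hab
  · rw [e2]; exact hΩ hx.2 hy.2 ha hb hab

lemma norm_le_of_mem_displacements (hΩ : Bornology.IsBounded Ω) {t : ℝ} {z δ : E d}
    (hδ : δ ∈ displacements Ω t z) : ‖δ‖ ≤ Metric.diam Ω := by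
  have h := Metric.dist_le_diam_of_mem hΩ hδ.2 hδ.1
  rw [dist_eq_norm] at h
  rwa [show z + (1 - t) • δ - (z - t • δ) = δ by module] at h

lemma isCompact_displacements (hΩ : IsCompact Ω) (t : ℝ) (z : E d) :
    IsCompact (displacements Ω t z) :=
  Metric.isCompact_of_isClosed_isBounded (isClosed_displacements hΩ.isClosed t z)
    ((Metric.isBounded_closedBall (x := (0 : E d)) (r := Metric.diam Ω)).subset fun _ hδ => by
      simpa using norm_le_of_mem_displacements hΩ.isBounded hδ)

lemma closedBall_subset_displacements {t ρ : ℝ} {z : E d} (ht : t ∈ Icc (0 : ℝ) 1)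
    (h : Metric.closedBall z ρ ⊆ Ω) : Metric.closedBall 0 ρ ⊆ displacements Ω t z := by
  intro δ hδ
  rw [mem_closedBall_zero_iff] at hδ
  have h0 := norm_nonneg δ
  constructor
  · apply h
    rw [Metric.mem_closedBall, dist_eq_norm, sub_sub_cancel_left, norm_neg, norm_smul,
      Real.norm_of_nonneg ht.1]
    nlinarith [ht.2]
  · apply h
    rw [Metric.mem_closedBall, dist_eq_norm, add_sub_cancel_left, norm_smul,
      Real.norm_of_nonneg (sub_nonneg.2 ht.2)]
    nlinarith [ht.1]

lemma zero_mem_displacements {t : ℝ} {z : E d} (hz : z ∈ Ω) : 0 ∈ displacements Ω t z := by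
  simp [displacements, hz]

lemma volume_displacements_pos {t : ℝ} {z : E d} (hΩ : IsCompact Ω) (ht : t ∈ Icc (0 : ℝ) 1)
    (hz : z ∈ interior Ω) : 0 < volume.real (displacements Ω t z) := by
  obtain ⟨ρ, hρ, h⟩ := Metric.nhds_basis_closedBall.mem_iff.1 (mem_interior_iff_mem_nhds.1 hz)
  have h1 : Metric.ball (0 : E d) ρ ⊆ displacements Ω t z :=
    Metric.ball_subset_closedBall.trans (closedBall_subset_displacements ht h)
  refine ENNReal.toReal_pos ?_ (isCompact_displacements hΩ t z).measure_lt_top.ne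
  exact ((Metric.measure_ball_pos volume (0 : E d) hρ).trans_le (measure_mono h1)).ne'

/-- Moving the base point `z` by at most `(c - 1) ρ` changes the set of displacements at most by
the dilation factor `c`. -/
lemma displacements_subset_smul {t ρ c : ℝ} {z z' : E d} (hΩ : Convex ℝ Ω) (hc : 1 < c)
    (h : Metric.closedBall z ρ ⊆ Ω) (hzz : ‖z - z'‖ ≤ (c - 1) * ρ) :
    displacements Ω t z' ⊆ c • displacements Ω t z := by
  intro δ hδ
  have hc0 : 0 < c := by linarith
  have hc1 : c - 1 ≠ 0 := by linarith
  -- The point `y₀ = z + (c - 1)⁻¹ (z - z')` of the ball is chosen so that `z + c⁻¹ y = c⁻¹ (z' + y)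
  -- + (1 - c⁻¹) y₀`, a convex combination in `Ω` whenever `z' + y` is in `Ω`.
  have hy : z + (c - 1)⁻¹ • (z - z') ∈ Ω := by
    apply h
    rw [Metric.mem_closedBall, dist_eq_norm, add_sub_cancel_left, norm_smul,
      Real.norm_of_nonneg (inv_nonneg.2 (by linarith)), inv_mul_le_iff₀ (by linarith)]
    exact hzz
  have key : ∀ y, z' + y ∈ Ω → z + c⁻¹ • y ∈ Ω := by
    intro y hy'
    have := hΩ hy' hy (a := c⁻¹) (b := 1 - c⁻¹) (by positivity)
      (sub_nonneg.2 (inv_le_one_of_one_le₀ hc.le)) (by ring)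
    convert this using 1
    have e : (1 - c⁻¹) * (c - 1)⁻¹ = c⁻¹ := by field_simp
    rw [smul_add, smul_add, smul_smul, e]
    module
  rw [mem_smul_set_iff_inv_smul_mem₀ hc0.ne']
  refine ⟨?_, ?_⟩
  · have := key (-(t • δ)) (by simpa [sub_eq_add_neg] using hδ.1)
    convert this using 1
    module
  · have := key ((1 - t) • δ) hδ.2
    convert this using 1
    module

/-- With `S = S_t(z)`, the difference lies in `c S \ S`. As `S` is convex and contains `0`, also `S
⊆ c S`, and dilation scales volume by `c ^ d`. -/
lemma volume_displacements_diff_le {t ρ c : ℝ} {z z' : E d} (hΩ : IsCompact Ω)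
    (hconv : Convex ℝ Ω) (hc : 1 < c) (hz : z ∈ Ω)
    (h : Metric.closedBall z ρ ⊆ Ω) (hzz : ‖z - z'‖ ≤ (c - 1) * ρ) :
    volume.real (displacements Ω t z' \ displacements Ω t z) ≤
      (c ^ d - 1) * volume.real (displacements Ω t z) := by
  set S := displacements Ω t z
  have hS : IsCompact S := isCompact_displacements hΩ t z
  have hc0 : 0 < c := by linarith
  have hsub : S ⊆ c • S := by
    intro δ hδ
    rw [mem_smul_set_iff_inv_smul_mem₀ hc0.ne']
    exact (convex_displacements hconv t z).smul_mem_of_zero_mem (zero_mem_displacements hz) hδ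
      ⟨by positivity, inv_le_one_of_one_le₀ hc.le⟩
  have hvol : volume.real (c • S) = c ^ d * volume.real S := by
    rw [measureReal_def, Measure.addHaar_smul, ENNReal.toReal_mul, ENNReal.toReal_ofReal
      (abs_nonneg _), abs_of_nonneg (by positivity), finrank_euclideanSpace_fin, measureReal_def]
  calc volume.real (displacements Ω t z' \ S)
      ≤ volume.real (c • S \ S) :=
        measureReal_mono (sdiff_subset_sdiff_left (displacements_subset_smul hconv hc h hzz))
          ((measure_mono sdiff_subset).trans_lt (hS.smul c).measure_lt_top).ne
    _ = _ := by
      rw [measureReal_sdiff hsub hS.measurableSet (hS.smul c).measure_lt_top.ne, hvol]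
      ring

lemma one_add_pow_sub_one_le {x : ℝ} (h0 : 0 ≤ x) (h1 : x ≤ 1) (n : ℕ) :
    (1 + x) ^ n - 1 ≤ 2 ^ n * x := by
  induction n with
  | zero => simpa using h0
  | succ n ih =>
    have : (1 + x) ^ n ≤ 2 ^ n := by gcongr; linarith
    rw [pow_succ, pow_succ]
    nlinarith

/-! ### The conditional density of the displacement -/

/-- The unnormalized conditional density of `X₁ - X₀` given `X_t = z`. -/
def weight (Ω : Set (E d)) (p₀ p₁ : E d → ℝ) (t : ℝ) (z δ : E d) : ℝ :=
  (displacements Ω t z).indicator (fun δ => p₀ (z - t • δ) * p₁ (z + (1 - t) • δ)) δ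

lemma weight_of_mem {t : ℝ} {z δ : E d} (h : δ ∈ displacements Ω t z) :
    weight Ω p₀ p₁ t z δ = p₀ (z - t • δ) * p₁ (z + (1 - t) • δ) := indicator_of_mem h _

lemma weight_of_notMem {t : ℝ} {z δ : E d} (h : δ ∉ displacements Ω t z) :
    weight Ω p₀ p₁ t z δ = 0 := indicator_of_notMem h _

namespace Admissible

variable (H : Admissible Ω p₀ p₁)
include H

lemma weight_nonneg (t : ℝ) (z δ : E d) : 0 ≤ weight Ω p₀ p₁ t z δ := by
  by_cases h : δ ∈ displacements Ω t z
  · rw [weight_of_mem h]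
    exact (mul_pos (H.left.pos h.1) (H.right.pos h.2)).le
  · rw [weight_of_notMem h]

lemma continuousOn_weight (t : ℝ) (z : E d) :
    ContinuousOn (fun δ => p₀ (z - t • δ) * p₁ (z + (1 - t) • δ)) (displacements Ω t z) :=
  (H.left.continuousOn.comp (by fun_prop : Continuous fun δ : E d => z - t • δ).continuousOn
    fun _ h => h.1).mul
    (H.right.continuousOn.comp
      (by fun_prop : Continuous fun δ : E d => z + (1 - t) • δ).continuousOn fun _ h => h.2)

lemma measurableSet_displacements (t : ℝ) (z : E d) : MeasurableSet (displacements Ω t z) :=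
  (isCompact_displacements H.compact t z).measurableSet

lemma integrable_weight (t : ℝ) (z : E d) : Integrable (weight Ω p₀ p₁ t z) :=
  (integrable_indicator_iff (H.measurableSet_displacements t z)).2
    ((H.continuousOn_weight t z).integrableOn_compact (isCompact_displacements H.compact t z))

omit H in
lemma weight_smul_eq (t : ℝ) (z : E d) : (fun δ => weight Ω p₀ p₁ t z δ • δ) =
    (displacements Ω t z).indicator
      (fun δ => (p₀ (z - t • δ) * p₁ (z + (1 - t) • δ)) • δ) := by
  ext1 δ
  by_cases h : δ ∈ displacements Ω t z
  · rw [weight_of_mem h, indicator_of_mem h]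
  · rw [weight_of_notMem h, indicator_of_notMem h, zero_smul]

lemma integrable_weight_smul (t : ℝ) (z : E d) :
    Integrable (fun δ => weight Ω p₀ p₁ t z δ • δ) := by
  rw [weight_smul_eq]
  exact (integrable_indicator_iff (H.measurableSet_displacements t z)).2
    (((H.continuousOn_weight t z).smul continuousOn_id).integrableOn_compact
      (isCompact_displacements H.compact t z))

lemma velocity_eq (t : ℝ) (z : E d) : velocity Ω p₀ p₁ t z =
    (∫ δ, weight Ω p₀ p₁ t z δ)⁻¹ • ∫ δ, weight Ω p₀ p₁ t z δ • δ := by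
  rw [weight_smul_eq, integral_indicator (H.measurableSet_displacements t z)]
  simp only [weight]
  rw [integral_indicator (H.measurableSet_displacements t z)]
  rfl

/-- Values of the weights are comparable to the mean value of the weight. -/
lemma weight_mul_volume_le (hd : 1 ≤ d) (t t' : ℝ) (z z' δ : E d) :
    weight Ω p₀ p₁ t' z' δ * volume.real (displacements Ω t z) ≤
      (2 ^ ⌈2 * Metric.diam Ω / omegaInvOne Ω p₀ p₁⌉₊) ^ 2 * ∫ δ, weight Ω p₀ p₁ t z δ := by
  set R : ℝ := 2 ^ ⌈2 * Metric.diam Ω / omegaInvOne Ω p₀ p₁⌉₊ with hR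
  have hR0 : 0 ≤ R := by positivity
  have hcS := isCompact_displacements H.compact t z
  by_cases h : δ ∈ displacements Ω t' z'
  · rw [← integral_const_mul]
    have h1 : weight Ω p₀ p₁ t' z' δ * volume.real (displacements Ω t z) =
        ∫ _ in displacements Ω t z, weight Ω p₀ p₁ t' z' δ := by
      rw [setIntegral_const, smul_eq_mul, mul_comm]
    rw [h1, ← integral_indicator hcS.measurableSet]
    refine integral_mono ((integrable_indicator_iff hcS.measurableSet).2
      (integrableOn_const hcS.measure_lt_top.ne)) ((H.integrable_weight t z).const_mul _) ?_
    intro δ'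
    by_cases h' : δ' ∈ displacements Ω t z
    · simp only [indicator_of_mem h']
      rw [weight_of_mem h, weight_of_mem h']
      have e0 := (H.density_le hd h.1 h'.1).1
      have e1 := (H.density_le hd h.2 h'.2).2
      have := H.right.pos h.2
      have := H.left.pos h'.1
      calc _ ≤ (R * p₀ (z - t • δ')) * (R * p₁ (z + (1 - t) • δ')) := by gcongr
        _ = _ := by ring
    · simp only [indicator_of_notMem h', weight_of_notMem h', mul_zero, le_refl]
  · rw [weight_of_notMem h, zero_mul]
    exact mul_nonneg (by positivity) (integral_nonneg fun δ => H.weight_nonneg t z δ)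

lemma integral_weight_pos {t : ℝ} {z : E d} (ht : t ∈ Icc (0 : ℝ) 1)
    (hz : z ∈ interior Ω) : 0 < ∫ δ, weight Ω p₀ p₁ t z δ := by
  rw [integral_pos_iff_support_of_nonneg (fun δ => H.weight_nonneg t z δ) (H.integrable_weight t z)]
  have h := volume_displacements_pos H.compact ht hz
  refine (ENNReal.toReal_pos_iff.1 h).1.trans_le (measure_mono fun δ hδ => ?_)
  rw [Function.mem_support, weight_of_mem hδ]
  exact (mul_pos (H.left.pos hδ.1) (H.right.pos hδ.2)).ne'

/-- A mean over a closed convex set stays in it. Both the speed bound `diam Ω` and the fact that the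
conditional mean of `X₁` lies in `Ω` are read off from this. -/
lemma velocity_mem {t : ℝ} {z : E d} (ht : t ∈ Icc (0 : ℝ) 1) (hz : z ∈ interior Ω) :
    velocity Ω p₀ p₁ t z ∈ displacements Ω t z := by
  rw [H.velocity_eq]
  refine weighted_mean_mem (isClosed_displacements H.compact.isClosed t z)
    (convex_displacements H.convex t z) (H.integrable_weight t z) (H.integrable_weight_smul t z)
    (Eventually.of_forall fun δ => H.weight_nonneg t z δ) (Eventually.of_forall fun δ h => ?_)
    (H.integral_weight_pos ht hz)
  by_contra hδ
  exact h (weight_of_notMem hδ)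

lemma norm_velocity_le {t : ℝ} {z : E d} (ht : t ∈ Icc (0 : ℝ) 1) (hz : z ∈ interior Ω) :
    ‖velocity Ω p₀ p₁ t z‖ ≤ Metric.diam Ω :=
  norm_le_of_mem_displacements H.compact.isBounded (H.velocity_mem ht hz)

/-- The velocities at two points differ at most by the total variation of the weights. -/
lemma norm_velocity_sub_le_of_weight {t B : ℝ} {z z' : E d} (ht : t ∈ Icc (0 : ℝ) 1)
    (hz : z ∈ interior Ω) (hz' : z' ∈ interior Ω)
    (h : ∫ δ, |weight Ω p₀ p₁ t z δ - weight Ω p₀ p₁ t z' δ| ≤ B * ∫ δ, weight Ω p₀ p₁ t z δ) :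
    ‖velocity Ω p₀ p₁ t z - velocity Ω p₀ p₁ t z'‖ ≤ 2 * Metric.diam Ω * B := by
  set W := weight Ω p₀ p₁ t z with hW
  set W' := weight Ω p₀ p₁ t z' with hW'
  have hF := H.integral_weight_pos ht hz
  have hF' := H.integral_weight_pos ht hz'
  have hi := H.integrable_weight t z
  have hi' := H.integrable_weight t z'
  have hD : 0 ≤ Metric.diam Ω := Metric.diam_nonneg
  -- Writing `F`, `F'` for the masses, `F (v - v') = ∫ (W - W') δ + (F' - F) v'`. As `‖δ‖` and
  -- `‖v'‖` are at most `diam Ω`, each term is at most `diam Ω` times the total variation, whence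
  -- the factor `2`.
  have e1 : (∫ δ, W δ) • (velocity Ω p₀ p₁ t z - velocity Ω p₀ p₁ t z') =
      (∫ δ, (W δ - W' δ) • δ) + (∫ δ, (W' δ - W δ)) • velocity Ω p₀ p₁ t z' := by
    simp only [sub_smul]
    rw [integral_sub (H.integrable_weight_smul t z) (H.integrable_weight_smul t z'),
      integral_sub hi' hi]
    have h1 : (∫ δ, W δ) • velocity Ω p₀ p₁ t z = ∫ δ, W δ • δ := by
      rw [H.velocity_eq, smul_inv_smul₀ hF.ne']
    have h2 : (∫ δ, W' δ) • velocity Ω p₀ p₁ t z' = ∫ δ, W' δ • δ := by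
      rw [H.velocity_eq, smul_inv_smul₀ hF'.ne']
    rw [smul_sub, h1, ← h2]
    module
  have hTV : Integrable fun δ => |W δ - W' δ| := (hi.sub hi').abs
  have e2 : ‖∫ δ, (W δ - W' δ) • δ‖ ≤ Metric.diam Ω * ∫ δ, |W δ - W' δ| := by
    rw [← integral_const_mul]
    refine norm_integral_le_of_norm_le (hTV.const_mul _) (Eventually.of_forall fun δ => ?_)
    rw [norm_smul, Real.norm_eq_abs, mul_comm]
    by_cases hδ : δ ∈ displacements Ω t z
    · exact mul_le_mul_of_nonneg_right
        (norm_le_of_mem_displacements H.compact.isBounded hδ) (abs_nonneg _)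
    by_cases hδ' : δ ∈ displacements Ω t z'
    · exact mul_le_mul_of_nonneg_right
        (norm_le_of_mem_displacements H.compact.isBounded hδ') (abs_nonneg _)
    · simp [hW, hW', weight_of_notMem hδ, weight_of_notMem hδ']
  have e3 : |∫ δ, (W' δ - W δ)| ≤ ∫ δ, |W δ - W' δ| := by
    refine (abs_integral_le_integral_abs).trans (le_of_eq ?_)
    simp only [abs_sub_comm]
  have e4 := H.norm_velocity_le ht hz'
  have e5 : (∫ δ, W δ) * ‖velocity Ω p₀ p₁ t z - velocity Ω p₀ p₁ t z'‖ ≤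
      2 * Metric.diam Ω * (B * ∫ δ, W δ) := by
    calc _ = ‖(∫ δ, W δ) • (velocity Ω p₀ p₁ t z - velocity Ω p₀ p₁ t z')‖ := by
          rw [norm_smul, Real.norm_of_nonneg hF.le]
      _ ≤ ‖∫ δ, (W δ - W' δ) • δ‖ + |∫ δ, (W' δ - W δ)| * ‖velocity Ω p₀ p₁ t z'‖ := by
          rw [e1]
          refine (norm_add_le _ _).trans ?_
          rw [norm_smul, Real.norm_eq_abs]
      _ ≤ Metric.diam Ω * (B * ∫ δ, W δ) + (B * ∫ δ, W δ) * Metric.diam Ω := by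
          gcongr
          · exact e2.trans (by gcongr)
          · exact (abs_nonneg _).trans (e3.trans h)
          · exact e3.trans h
      _ = _ := by ring
  rw [show 2 * Metric.diam Ω * (B * ∫ δ, W δ) = (∫ δ, W δ) * (2 * Metric.diam Ω * B) by ring] at e5
  exact le_of_mul_le_mul_left e5 hF

/-- A product of two ratios within `ω` of `1` is within `2ω + ω² ≤ 3ω` of `1`, as `ω ≤ 1`. -/
lemma abs_weight_sub_le {t : ℝ} {z z' δ : E d} (hω : omega Ω p₀ p₁ ‖z - z'‖ ≤ 1)
    (h : δ ∈ displacements Ω t z) (h' : δ ∈ displacements Ω t z') :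
    |weight Ω p₀ p₁ t z δ - weight Ω p₀ p₁ t z' δ| ≤
      3 * omega Ω p₀ p₁ ‖z - z'‖ * weight Ω p₀ p₁ t z δ := by
  have hW := (mul_pos (H.left.pos h.1) (H.right.pos h.2))
  have h0 := omega_nonneg (Ω := Ω) (p₀ := p₀) (p₁ := p₁) ‖z - z'‖
  have e0 := (le_max_left _ _).trans (H.max_le_omega (η := ‖z - z'‖) h'.1 h.1
    (by rw [norm_sub_rev]; simp))
  have e1 := (le_max_right _ _).trans (H.max_le_omega (η := ‖z - z'‖) h'.2 h.2
    (by rw [norm_sub_rev]; simp))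
  have e2 := abs_mul_sub_one_le e0 e1
  rw [weight_of_mem h, weight_of_mem h']
  have hp := (H.left.pos h.1).ne'
  have hq := (H.right.pos h.2).ne'
  rw [div_mul_div_comm, div_sub_one hW.ne', abs_div, abs_of_pos hW, div_le_iff₀ hW,
    abs_sub_comm] at e2
  refine e2.trans ?_
  gcongr
  nlinarith

end Admissible

/-! ### Modulus of continuity of the velocity away from the boundary -/

/-- The constant in the modulus of continuity of the velocity. -/
def velocityConst (d : ℕ) (D w : ℝ) : ℝ := 6 * |D| * 4 ^ d * (2 ^ ⌈2 * D / w⌉₊) ^ 2 + 1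

lemma velocityConst_pos (d : ℕ) (D w : ℝ) : 0 < velocityConst d D w := by
  unfold velocityConst
  positivity

namespace Admissible

variable (H : Admissible Ω p₀ p₁)
include H

/-- On `S ∩ S'` the weights differ by the relative error `3ω`. On the symmetric difference one
weight vanishes and the other is at most `R²` times the mean of the weight at `z`, so only the
volume of that set matters. -/
lemma integral_abs_weight_sub_le (hd : 1 ≤ d) {t ρ : ℝ} {z z' : E d} (ht : t ∈ Icc (0 : ℝ) 1)
    (hρ : 0 < ρ) (hz : Metric.closedBall z ρ ⊆ Ω) (hz' : Metric.closedBall z' ρ ⊆ Ω)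
    (hne : z ≠ z') (hh : ‖z - z'‖ ≤ ρ) (hω : omega Ω p₀ p₁ ‖z - z'‖ ≤ 1) :
    ∫ δ, |weight Ω p₀ p₁ t z δ - weight Ω p₀ p₁ t z' δ| ≤
      (3 * omega Ω p₀ p₁ ‖z - z'‖ +
        2 * 4 ^ d * (2 ^ ⌈2 * Metric.diam Ω / omegaInvOne Ω p₀ p₁⌉₊) ^ 2 * (‖z - z'‖ / ρ)) *
        ∫ δ, weight Ω p₀ p₁ t z δ := by
  set R : ℝ := 2 ^ ⌈2 * Metric.diam Ω / omegaInvOne Ω p₀ p₁⌉₊ with hR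
  set S := displacements Ω t z with hS
  set S' := displacements Ω t z' with hS'
  set F := ∫ δ, weight Ω p₀ p₁ t z δ with hF
  set h := ‖z - z'‖ with hh'
  have hzi : z ∈ interior Ω := mem_interior_iff_mem_nhds.2
    (Metric.nhds_basis_closedBall.mem_iff.2 ⟨ρ, hρ, hz⟩)
  have hV := volume_displacements_pos H.compact ht hzi
  rw [← hS] at hV
  have hF0 : 0 < F := H.integral_weight_pos ht hzi
  have hcS := isCompact_displacements H.compact t z
  have hcS' := isCompact_displacements H.compact t z'
  have hhpos : 0 < h := norm_pos_iff.2 (sub_ne_zero.2 hne)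
  set c := 1 + h / ρ with hc
  have hc1 : 1 < c := by rw [hc]; linarith [div_pos hhpos hρ]
  have hx1 : h / ρ ≤ 1 := (div_le_one hρ).2 hh
  have hc2 : c ^ d ≤ 2 ^ d := by
    gcongr
    linarith
  have hc3 : c ^ d - 1 ≤ 2 ^ d * (h / ρ) := one_add_pow_sub_one_le (by positivity) hx1 d
  have hc4 : 0 ≤ c ^ d - 1 := by linarith [one_le_pow₀ hc1.le (n := d)]
  have hcρ : (c - 1) * ρ = h := by rw [hc]; field_simp; ring
  have v1 : volume.real (S' \ S) ≤ (c ^ d - 1) * volume.real S :=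
    volume_displacements_diff_le H.compact H.convex hc1 (interior_subset hzi) hz
      (by rw [hcρ])
  have v2 : volume.real (S \ S') ≤ (c ^ d - 1) * volume.real S' :=
    volume_displacements_diff_le H.compact H.convex hc1 (hz' (Metric.mem_closedBall_self hρ.le)) hz'
      (by rw [hcρ, norm_sub_rev])
  -- The bound `v2` is relative to the volume of `S'`; this refers it back to `S`.
  have v3 : volume.real S' ≤ c ^ d * volume.real S := by
    calc volume.real S' ≤ volume.real (S' \ S ∪ S) :=
          measureReal_mono (by rw [sdiff_union_self]; exact subset_union_left)
            ((measure_union_le _ _).trans_lt (ENNReal.add_lt_top.2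
              ⟨(measure_mono sdiff_subset).trans_lt hcS'.measure_lt_top, hcS.measure_lt_top⟩)).ne
      _ ≤ volume.real (S' \ S) + volume.real S := measureReal_union_le _ _
      _ ≤ _ := by linarith
  set N := (S \ S') ∪ (S' \ S) with hN
  have hNm : MeasurableSet N := (hcS.measurableSet.diff hcS'.measurableSet).union
    (hcS'.measurableSet.diff hcS.measurableSet)
  have hNfin : volume N < ⊤ := (measure_union_le _ _).trans_lt (ENNReal.add_lt_top.2
    ⟨(measure_mono sdiff_subset).trans_lt hcS.measure_lt_top,
      (measure_mono sdiff_subset).trans_lt hcS'.measure_lt_top⟩)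
  have v4 : volume.real N ≤ 2 * 4 ^ d * (h / ρ) * volume.real S := by
    have h2 : (1 : ℝ) ≤ 2 ^ d := one_le_pow₀ (by norm_num)
    have h4 : (4 : ℝ) ^ d = 2 ^ d * 2 ^ d := by rw [← mul_pow]; norm_num
    calc volume.real N ≤ volume.real (S \ S') + volume.real (S' \ S) := measureReal_union_le _ _
      _ ≤ (c ^ d - 1) * (c ^ d * volume.real S) + (c ^ d - 1) * volume.real S := by
          gcongr
          exact v2.trans (by gcongr)
      _ = (c ^ d - 1) * (c ^ d + 1) * volume.real S := by ring
      _ ≤ (2 ^ d * (h / ρ)) * (2 ^ d + 2 ^ d) * volume.real S := by gcongr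
      _ = _ := by rw [h4]; ring
  set M := R ^ 2 * F / volume.real S with hM
  have hM0 : 0 ≤ M := by positivity
  have hWM : ∀ y δ, weight Ω p₀ p₁ t y δ ≤ M := by
    intro y δ
    rw [hM, le_div_iff₀ hV]
    exact H.weight_mul_volume_le hd t t z y δ
  have hω0 := omega_nonneg (Ω := Ω) (p₀ := p₀) (p₁ := p₁) h
  have hpt : ∀ δ, |weight Ω p₀ p₁ t z δ - weight Ω p₀ p₁ t z' δ| ≤
      3 * omega Ω p₀ p₁ h * weight Ω p₀ p₁ t z δ + N.indicator (fun _ => M) δ := by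
    intro δ
    have hind : 0 ≤ N.indicator (fun _ => M) δ := indicator_nonneg (fun _ _ => hM0) δ
    have hw := H.weight_nonneg t z δ
    have hw' := H.weight_nonneg t z' δ
    have hωw : 0 ≤ 3 * omega Ω p₀ p₁ h * weight Ω p₀ p₁ t z δ := by positivity
    by_cases h1 : δ ∈ S <;> by_cases h2 : δ ∈ S'
    · linarith [H.abs_weight_sub_le hω h1 h2]
    · rw [indicator_of_mem (show δ ∈ N from Or.inl ⟨h1, h2⟩), weight_of_notMem h2, sub_zero, abs_of_nonneg hw]
      linarith [hWM z δ]
    · rw [indicator_of_mem (show δ ∈ N from Or.inr ⟨h2, h1⟩), weight_of_notMem h1, zero_sub, abs_neg,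
        abs_of_nonneg hw', mul_zero, zero_add]
      exact hWM z' δ
    · rw [weight_of_notMem h1, weight_of_notMem h2, sub_zero, abs_zero, mul_zero, zero_add]
      exact hind
  have hi1 : Integrable fun δ => 3 * omega Ω p₀ p₁ h * weight Ω p₀ p₁ t z δ :=
    (H.integrable_weight t z).const_mul _
  have hi2 : Integrable (N.indicator fun _ => M) :=
    (integrable_indicator_iff hNm).2 (integrableOn_const hNfin.ne)
  calc _ ≤ ∫ δ, (3 * omega Ω p₀ p₁ h * weight Ω p₀ p₁ t z δ + N.indicator (fun _ => M) δ) :=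
        integral_mono ((H.integrable_weight t z).sub (H.integrable_weight t z')).abs
          (hi1.add hi2) hpt
    _ = 3 * omega Ω p₀ p₁ h * F + volume.real N * M := by
        rw [integral_add hi1 hi2, integral_const_mul, integral_indicator hNm, setIntegral_const,
          smul_eq_mul]
    _ ≤ 3 * omega Ω p₀ p₁ h * F + 2 * 4 ^ d * (h / ρ) * volume.real S * M := by gcongr
    _ = _ := by rw [hM]; field_simp

/-- The modulus of continuity of the velocity field away from the boundary. -/
lemma norm_velocity_sub_le (hd : 1 ≤ d) {t ρ : ℝ} {z z' : E d} (ht : t ∈ Icc (0 : ℝ) 1)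
    (hρ : 0 < ρ) (hz : Metric.closedBall z ρ ⊆ Ω) (hz' : Metric.closedBall z' ρ ⊆ Ω) :
    ‖velocity Ω p₀ p₁ t z - velocity Ω p₀ p₁ t z'‖ ≤
      velocityConst d (Metric.diam Ω) (omegaInvOne Ω p₀ p₁) * (1 + 1 / ρ) *
        (‖z - z'‖ + omega Ω p₀ p₁ ‖z - z'‖) := by
  have hzi : z ∈ interior Ω := mem_interior_iff_mem_nhds.2
    (Metric.nhds_basis_closedBall.mem_iff.2 ⟨ρ, hρ, hz⟩)
  have hzi' : z' ∈ interior Ω := mem_interior_iff_mem_nhds.2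
    (Metric.nhds_basis_closedBall.mem_iff.2 ⟨ρ, hρ, hz'⟩)
  have hω0 := omega_nonneg (Ω := Ω) (p₀ := p₀) (p₁ := p₁) ‖z - z'‖
  have hA := velocityConst_pos d (Metric.diam Ω) (omegaInvOne Ω p₀ p₁)
  have hh0 := norm_nonneg (z - z')
  rcases eq_or_ne z z' with rfl | hne
  · rw [sub_self, norm_zero]
    positivity
  have hD : 0 ≤ Metric.diam Ω := Metric.diam_nonneg
  set R : ℝ := 2 ^ ⌈2 * Metric.diam Ω / omegaInvOne Ω p₀ p₁⌉₊ with hR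
  set h := ‖z - z'‖
  set D := Metric.diam Ω
  set q := omega Ω p₀ p₁ h
  have hR1 : 1 ≤ R := one_le_pow₀ (by norm_num)
  have hR2 : (1 : ℝ) ≤ 4 ^ d * R ^ 2 := by
    have h4 : (1 : ℝ) ≤ 4 ^ d := one_le_pow₀ (by norm_num)
    have := one_le_pow₀ hR1 (n := 2)
    nlinarith
  have hA1 : 6 * D * (4 ^ d * R ^ 2) ≤ velocityConst d D (omegaInvOne Ω p₀ p₁) := by
    rw [velocityConst, abs_of_nonneg hD]
    nlinarith
  have hA2 : 6 * D ≤ 6 * D * (4 ^ d * R ^ 2) := le_mul_of_one_le_right (by positivity) hR2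
  have hfac : q + h / ρ ≤ (1 + 1 / ρ) * (h + q) := by
    have : (1 + 1 / ρ) * (h + q) = q + h / ρ + (h + q / ρ) := by ring
    rw [this]
    have : 0 ≤ h + q / ρ := by positivity
    linarith
  have hsuff : ‖velocity Ω p₀ p₁ t z - velocity Ω p₀ p₁ t z'‖ ≤
      6 * D * (4 ^ d * R ^ 2) * (q + h / ρ) := ?_
  · rw [mul_assoc]
    refine hsuff.trans ?_
    gcongr
  -- If the comparison of weights is not available, then `q + h / ρ ≥ 1` and the trivial bound `2 D`
  -- on the difference of velocities suffices.
  by_cases hcase : h ≤ ρ ∧ q ≤ 1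
  · refine (H.norm_velocity_sub_le_of_weight ht hzi hzi'
      (H.integral_abs_weight_sub_le hd ht hρ hz hz' hne hcase.1 hcase.2)).trans ?_
    have e1 : 2 * D * (3 * q + 2 * 4 ^ d * R ^ 2 * (h / ρ)) =
      6 * D * q + 4 * D * (4 ^ d * R ^ 2) * (h / ρ) := by ring
    have hhρ : 0 ≤ h / ρ := by positivity
    have hX : 0 ≤ D * (4 ^ d * R ^ 2) := by positivity
    rw [e1]
    have e2 := mul_le_mul_of_nonneg_right hA2 hω0
    have e3 := mul_nonneg hX hhρ
    nlinarith
  · have h1 : 1 ≤ q + h / ρ := by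
      rw [not_and_or, not_le, not_le] at hcase
      have hhρ : 0 ≤ h / ρ := by positivity
      rcases hcase with h1 | h1
      · have := (one_lt_div hρ).2 h1
        linarith
      · linarith
    calc _ ≤ D + D := (norm_sub_le _ _).trans
          (add_le_add (H.norm_velocity_le ht hzi) (H.norm_velocity_le ht hzi'))
      _ ≤ 6 * D * 1 := by linarith
      _ ≤ 6 * D * (4 ^ d * R ^ 2) * (q + h / ρ) := by
        rw [mul_assoc (6 * D)]
        gcongr
        nlinarith

/-! ### Continuity of the velocity field -/

/-- For fixed `δ` the indicator can jump only if `δ` is on the frontier of `S_t(z)`. If `δ` is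
interior, then `c δ ∈ S_t(z)` for some `c > 1`, so both end points lie strictly between the interior
point `z` and a point of `Ω`; they are interior to `Ω` and remain so nearby. If `δ` is outside,
closedness of `Ω` keeps it outside. -/
lemma continuousAt_weight {t : ℝ} {z δ : E d} (hz : z ∈ interior Ω)
    (hδ : δ ∉ frontier (displacements Ω t z)) :
    ContinuousAt (fun q : ℝ × E d => weight Ω p₀ p₁ q.1 q.2 δ) (t, z) := by
  have c0 : ContinuousAt (fun q : ℝ × E d => q.2 - q.1 • δ) (t, z) := by fun_prop
  have c1 : ContinuousAt (fun q : ℝ × E d => q.2 + (1 - q.1) • δ) (t, z) := by fun_prop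
  have hcl := H.compact.isClosed
  by_cases hmem : δ ∈ displacements Ω t z
  · have hint : δ ∈ interior (displacements Ω t z) := by
      by_contra h
      exact hδ ⟨subset_closure hmem, h⟩
    obtain ⟨c, hc, hcδ⟩ : ∃ c : ℝ, 1 < c ∧ c • δ ∈ displacements Ω t z := by
      have hcont : Tendsto (fun c : ℝ => c • δ) (𝓝 1) (𝓝 δ) := by
        have : Continuous fun c : ℝ => c • δ := by fun_prop
        simpa using this.tendsto 1
      have h1 : ∀ᶠ c : ℝ in 𝓝[>] 1, c • δ ∈ displacements Ω t z :=
        (hcont.mono_left nhdsWithin_le_nhds).eventually (mem_interior_iff_mem_nhds.1 hint)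
      obtain ⟨c, h1, h2⟩ := (h1.and self_mem_nhdsWithin).exists
      exact ⟨c, h2, h1⟩
    have hseg : ∀ y : E d, z + c • y ∈ Ω → z + y ∈ interior Ω := by
      intro y hy
      refine H.convex.openSegment_interior_self_subset_interior hz hy
        ⟨1 - c⁻¹, c⁻¹, ?_, by positivity, by ring, ?_⟩
      · exact sub_pos.2 (inv_lt_one_of_one_lt₀ hc)
      · rw [smul_add, smul_smul, inv_mul_cancel₀ (by positivity)]
        module
    have m0 : z - t • δ ∈ interior Ω := by
      have := hseg (-(t • δ)) (by convert hcδ.1 using 1; module)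
      simpa [sub_eq_add_neg] using this
    have m1 : z + (1 - t) • δ ∈ interior Ω := hseg _ (by convert hcδ.2 using 1; module)
    have ev : ∀ᶠ q : ℝ × E d in 𝓝 (t, z),
        q.2 - q.1 • δ ∈ interior Ω ∧ q.2 + (1 - q.1) • δ ∈ interior Ω :=
      (c0.eventually (isOpen_interior.mem_nhds m0)).and
        (c1.eventually (isOpen_interior.mem_nhds m1))
    have hmain : ContinuousAt
        (fun q : ℝ × E d => p₀ (q.2 - q.1 • δ) * p₁ (q.2 + (1 - q.1) • δ)) (t, z) := by
      refine ContinuousAt.mul ?_ ?_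
      · exact ContinuousAt.comp (f := fun q : ℝ × E d => q.2 - q.1 • δ)
          (H.left.continuousOn.continuousAt (mem_interior_iff_mem_nhds.1 m0)) c0
      · exact ContinuousAt.comp (f := fun q : ℝ × E d => q.2 + (1 - q.1) • δ)
          (H.right.continuousOn.continuousAt (mem_interior_iff_mem_nhds.1 m1)) c1
    refine hmain.congr ?_
    filter_upwards [ev] with q hq
    rw [weight_of_mem ⟨interior_subset hq.1, interior_subset hq.2⟩]
  · have ev : ∀ᶠ q : ℝ × E d in 𝓝 (t, z), weight Ω p₀ p₁ q.1 q.2 δ = 0 := by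
      rw [displacements, mem_ofPred_eq, not_and_or] at hmem
      rcases hmem with h | h
      · filter_upwards [c0.eventually (hcl.isOpen_compl.mem_nhds h)] with q hq
        exact weight_of_notMem fun hm => hq hm.1
      · filter_upwards [c1.eventually (hcl.isOpen_compl.mem_nhds h)] with q hq
        exact weight_of_notMem fun hm => hq hm.2
    exact (continuousAt_const (y := (0 : ℝ))).congr (ev.mono fun q hq => hq.symm)

lemma exists_weight_bound : ∃ M : ℝ, 0 ≤ M ∧ ∀ t z δ,
    weight Ω p₀ p₁ t z δ ≤ (Metric.closedBall 0 (Metric.diam Ω)).indicator (fun _ => M) δ := by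
  obtain ⟨M, hM, h⟩ := H.left.bounded_above H.compact
  obtain ⟨M', hM', h'⟩ := H.right.bounded_above H.compact
  refine ⟨M * M', by positivity, fun t z δ => ?_⟩
  by_cases hδ : δ ∈ displacements Ω t z
  · rw [weight_of_mem hδ, indicator_of_mem]
    · have := h _ hδ.1
      have := h' _ hδ.2
      have := H.right.pos hδ.2
      gcongr
    · simpa using norm_le_of_mem_displacements H.compact.isBounded hδ
  · rw [weight_of_notMem hδ]
    exact indicator_nonneg (fun _ _ => by positivity) δ

/-- The frontier of a convex set is a null set, so the weights are continuous at `(t, z)` for almost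
every `δ`, and dominated convergence applies to both integrals. -/
lemma continuousAt_velocity {t : ℝ} {z : E d} (ht : t ∈ Icc (0 : ℝ) 1) (hz : z ∈ interior Ω) :
    ContinuousAt (fun q : ℝ × E d => velocity Ω p₀ p₁ q.1 q.2) (t, z) := by
  obtain ⟨M, hM, hWM⟩ := H.exists_weight_bound
  have hD : 0 ≤ Metric.diam Ω := Metric.diam_nonneg
  have hae : ∀ᵐ δ : E d, δ ∉ frontier (displacements Ω t z) :=
    measure_eq_zero_iff_ae_notMem.1 ((convex_displacements H.convex t z).addHaar_frontier volume)
  have hball : IsCompact (Metric.closedBall (0 : E d) (Metric.diam Ω)) :=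
    isCompact_closedBall _ _
  have hbint : ∀ C : ℝ, Integrable
      ((Metric.closedBall (0 : E d) (Metric.diam Ω)).indicator fun _ => C) := fun C =>
    (integrable_indicator_iff hball.measurableSet).2 (integrableOn_const hball.measure_lt_top.ne)
  have c0 : ContinuousAt (fun q : ℝ × E d => ∫ δ, weight Ω p₀ p₁ q.1 q.2 δ) (t, z) := by
    refine continuousAt_of_dominated (Eventually.of_forall fun q =>
      (H.integrable_weight q.1 q.2).aestronglyMeasurable) (Eventually.of_forall fun q =>
      Eventually.of_forall fun δ => ?_) (hbint M) ?_
    · rw [Real.norm_of_nonneg (H.weight_nonneg _ _ _)]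
      exact hWM q.1 q.2 δ
    · filter_upwards [hae] with δ hδ using H.continuousAt_weight hz hδ
  have c1 : ContinuousAt (fun q : ℝ × E d => ∫ δ, weight Ω p₀ p₁ q.1 q.2 δ • δ) (t, z) := by
    refine continuousAt_of_dominated (Eventually.of_forall fun q =>
      (H.integrable_weight_smul q.1 q.2).aestronglyMeasurable) (Eventually.of_forall fun q =>
      Eventually.of_forall fun δ => ?_) (hbint (M * Metric.diam Ω)) ?_
    · rw [norm_smul, Real.norm_of_nonneg (H.weight_nonneg _ _ _)]
      have h1 := hWM q.1 q.2 δ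
      by_cases hδ : δ ∈ Metric.closedBall (0 : E d) (Metric.diam Ω)
      · rw [indicator_of_mem hδ] at h1 ⊢
        have := mem_closedBall_zero_iff.1 hδ
        gcongr
      · rw [indicator_of_notMem hδ] at h1 ⊢
        nlinarith [norm_nonneg δ]
    · filter_upwards [hae] with δ hδ using (H.continuousAt_weight hz hδ).smul continuousAt_const
  have hmain := (c0.inv₀ (H.integral_weight_pos ht hz).ne').smul c1
  refine hmain.congr (Eventually.of_forall fun q => ?_)
  exact (H.velocity_eq q.1 q.2).symm

end Admissible

/-! ### Rectified paths stay away from the boundary -/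

/-- The conditional mean of `X₁` given `X_t = z`. -/
def terminalMean (Ω : Set (E d)) (p₀ p₁ : E d → ℝ) (t : ℝ) (z : E d) : E d :=
  z + (1 - t) • velocity Ω p₀ p₁ t z

lemma hasDerivAt_inv_one_sub {s : ℝ} (hs : 1 - s ≠ 0) :
    HasDerivAt (fun s : ℝ => (1 - s)⁻¹) ((1 - s) ^ 2)⁻¹ s := by
  have h : HasDerivAt (fun s : ℝ => (1 - s)⁻¹) (-(-1) / (1 - s) ^ 2) s :=
    ((hasDerivAt_id s).const_sub 1).inv hs
  simpa using h

lemma integral_inv_one_sub_sq {t : ℝ} (h0 : 0 ≤ t) (h1 : t < 1) :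
    ∫ s in (0 : ℝ)..t, ((1 - s) ^ 2)⁻¹ = t / (1 - t) := by
  have hne : ∀ s ∈ uIcc 0 t, 1 - s ≠ 0 := by
    intro s hs
    rw [uIcc_of_le h0] at hs
    linarith [hs.2]
  rw [intervalIntegral.integral_eq_sub_of_hasDerivAt (fun s hs => hasDerivAt_inv_one_sub (hne s hs))
    (ContinuousOn.intervalIntegrable (by
      refine ContinuousOn.inv₀ (by fun_prop) fun s hs => pow_ne_zero 2 (hne s hs)))]
  have := hne t right_mem_uIcc
  field_simp
  ring

/-- The ball is the image of the one around `x` under the homothety with centre `y` and ratio `1 -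
t`. -/
lemma closedBall_subset_of_mem_segment {x y : E d} {ρ t : ℝ} (hΩ : Convex ℝ Ω)
    (hx : Metric.closedBall x ρ ⊆ Ω) (hy : y ∈ Ω) (h0 : 0 ≤ t) (h1 : t < 1) :
    Metric.closedBall ((1 - t) • x + t • y) ((1 - t) * ρ) ⊆ Ω := by
  intro b hb
  have ht : 0 < 1 - t := by linarith
  have hx' : x + (1 - t)⁻¹ • (b - ((1 - t) • x + t • y)) ∈ Ω := by
    apply hx
    rw [Metric.mem_closedBall, dist_eq_norm, add_sub_cancel_left, norm_smul,
      Real.norm_of_nonneg (by positivity), inv_mul_le_iff₀ ht, ← dist_eq_norm]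
    exact hb
  have := hΩ hx' hy ht.le h0 (by ring)
  rw [smul_add, smul_inv_smul₀ ht.ne'] at this
  convert this using 1
  module

/-- Weighted means of points of `Ω` with the starting point `x` keep a distance from the boundary. -/
lemma closedBall_subset_of_integral {x : E d} {ρ t : ℝ} {g : ℝ → E d} (hcl : IsClosed Ω)
    (hΩ : Convex ℝ Ω) (hx : Metric.closedBall x ρ ⊆ Ω) (h0 : 0 ≤ t) (h1 : t < 1)
    (hg : ∀ s ∈ Icc 0 t, g s ∈ Ω)
    (hi : IntervalIntegrable (fun s => ((1 - s) ^ 2)⁻¹ • g s) volume 0 t) :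
    Metric.closedBall ((1 - t) • (x + ∫ s in (0 : ℝ)..t, ((1 - s) ^ 2)⁻¹ • g s)) ((1 - t) * ρ) ⊆
      Ω := by
  rcases h0.eq_or_lt with rfl | h0'
  · simpa using hx
  have ht : 0 < 1 - t := by linarith
  have hI := integral_inv_one_sub_sq h0 h1
  have hw : IntervalIntegrable (fun s : ℝ => ((1 - s) ^ 2)⁻¹) volume 0 t := by
    refine ContinuousOn.intervalIntegrable (ContinuousOn.inv₀ (by fun_prop) fun s hs => ?_)
    rw [uIcc_of_le h0] at hs
    have : 0 < 1 - s := by linarith [hs.2]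
    positivity
  rw [intervalIntegrable_iff_integrableOn_Ioc_of_le h0] at hi hw
  rw [intervalIntegral.integral_of_le h0] at hI
  -- The total mass of the weights is `t / (1 - t)`, so the centre of the ball is `(1 - t) x + t y`
  -- with `y ∈ Ω` the normalized mean.
  have hmem := weighted_mean_mem hcl hΩ hw hi
    (Eventually.of_forall fun s => inv_nonneg.2 (sq_nonneg _))
    (by
      filter_upwards [ae_restrict_mem measurableSet_Ioc] with s hs _
      exact hg s ⟨hs.1.le, hs.2⟩) (by rw [hI]; positivity)
  rw [hI] at hmem
  have := closedBall_subset_of_mem_segment hΩ hx hmem h0 h1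
  rw [intervalIntegral.integral_of_le h0]
  convert this using 2
  rw [smul_add, smul_smul]
  congr 2
  field_simp

lemma mem_interior_of_closedBall {x : E d} {ρ : ℝ} (hρ : 0 < ρ) (h : Metric.closedBall x ρ ⊆ Ω) :
    x ∈ interior Ω :=
  mem_interior_iff_mem_nhds.2 (Metric.nhds_basis_closedBall.mem_iff.2 ⟨ρ, hρ, h⟩)

lemma exists_closedBall_subset {x : E d} (h : x ∈ interior Ω) :
    ∃ ρ > 0, Metric.closedBall x ρ ⊆ Ω :=
  Metric.nhds_basis_closedBall.mem_iff.1 (mem_interior_iff_mem_nhds.1 h)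

namespace Admissible

variable (H : Admissible Ω p₀ p₁)
include H

lemma terminalMean_mem {t : ℝ} {z : E d} (ht : t ∈ Icc (0 : ℝ) 1) (hz : z ∈ interior Ω) :
    terminalMean Ω p₀ p₁ t z ∈ Ω := (H.velocity_mem ht hz).2

lemma norm_path_sub_le {x : E d} {z : ℝ → E d} (hz : IsRectifiedPath Ω p₀ p₁ x z) {s t : ℝ}
    (hs : s ∈ Icc (0 : ℝ) 1) (ht : t ∈ Icc (0 : ℝ) 1) :
    ‖z t - z s‖ ≤ Metric.diam Ω * |t - s| := by
  have hi : ∀ t ∈ Icc (0 : ℝ) 1,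
      IntervalIntegrable (fun s => velocity Ω p₀ p₁ s (z s)) volume 0 t := fun t ht =>
    hz.integrable.mono_set (by
      rw [uIcc_of_le ht.1, uIcc_of_le zero_le_one]; exact Icc_subset_Icc_right ht.2)
  rw [hz.integral_eq t ht, hz.integral_eq s hs, add_sub_add_left_eq_sub,
    intervalIntegral.integral_interval_sub_left (hi t ht) (hi s hs)]
  refine intervalIntegral.norm_integral_le_of_norm_le_const_ae ?_
  -- At time `1` the path may be on the boundary, where the speed bound is not available; this
  -- single time is negligible.
  filter_upwards [Measure.ae_ne volume (1 : ℝ)] with u hu1 hu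
  have hu' : u ∈ Icc (0 : ℝ) 1 := by
    rcases le_total s t with h | h
    · rw [uIoc_of_le h] at hu
      exact ⟨hs.1.trans hu.1.le, hu.2.trans ht.2⟩
    · rw [uIoc_of_ge h] at hu
      exact ⟨ht.1.trans hu.1.le, hu.2.trans hs.2⟩
  exact H.norm_velocity_le hu' (hz.mem_interior u ⟨hu'.1, lt_of_le_of_ne hu'.2 hu1⟩)

lemma continuousOn_path {x : E d} {z : ℝ → E d} (hz : IsRectifiedPath Ω p₀ p₁ x z) :
    ContinuousOn z (Icc 0 1) := by
  refine (LipschitzOnWith.of_dist_le_mul (K := ⟨Metric.diam Ω, Metric.diam_nonneg⟩)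
    fun t ht s hs => ?_).continuousOn
  rw [dist_eq_norm, Real.dist_eq]
  exact H.norm_path_sub_le hz hs ht

lemma continuousOn_velocity_comp {z : ℝ → E d} (hc : ContinuousOn z (Ico 0 1))
    (hz : ∀ t ∈ Ico (0 : ℝ) 1, z t ∈ interior Ω) :
    ContinuousOn (fun s => velocity Ω p₀ p₁ s (z s)) (Ico 0 1) := fun t ht =>
  ContinuousAt.comp_continuousWithinAt (f := fun s => (s, z s))
    (g := fun q : ℝ × E d => velocity Ω p₀ p₁ q.1 q.2)
    (H.continuousAt_velocity ⟨ht.1, ht.2.le⟩ (hz t ht))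
    (continuousWithinAt_id.prodMk (hc t ht))

lemma continuousOn_terminalMean_comp {z : ℝ → E d} (hc : ContinuousOn z (Ico 0 1))
    (hz : ∀ t ∈ Ico (0 : ℝ) 1, z t ∈ interior Ω) :
    ContinuousOn (fun s => ((1 - s) ^ 2)⁻¹ • terminalMean Ω p₀ p₁ s (z s)) (Ico 0 1) := by
  have h1 : ContinuousOn (fun s : ℝ => 1 - s) (Ico 0 1) := by fun_prop
  refine ((h1.pow 2).inv₀ fun s hs => ?_).smul
    (hc.add (h1.smul (H.continuousOn_velocity_comp hc hz)))
  exact pow_ne_zero 2 (sub_pos.2 hs.2).ne'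

lemma hasDerivAt_path {x : E d} {z : ℝ → E d} (hz : IsRectifiedPath Ω p₀ p₁ x z) {t : ℝ}
    (ht : t ∈ Ioo (0 : ℝ) 1) : HasDerivAt z (velocity Ω p₀ p₁ t (z t)) t := by
  have hv := H.continuousOn_velocity_comp
    ((H.continuousOn_path hz).mono Ico_subset_Icc_self) hz.mem_interior
  have hv' := hv.mono Ioo_subset_Ico_self
  have h1 : HasDerivAt (fun t => x + ∫ s in (0 : ℝ)..t, velocity Ω p₀ p₁ s (z s))
      (velocity Ω p₀ p₁ t (z t)) t := by
    refine HasDerivAt.const_add _ (intervalIntegral.integral_hasDerivAt_right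
      (hz.integrable.mono_set ?_) (hv'.stronglyMeasurableAtFilter isOpen_Ioo _ ht)
      (hv'.continuousAt (isOpen_Ioo.mem_nhds ht)))
    rw [uIcc_of_le ht.1.le, uIcc_of_le zero_le_one]
    exact Icc_subset_Icc_right ht.2.le
  refine h1.congr_of_eventuallyEq ?_
  filter_upwards [isOpen_Ioo.mem_nhds ht] with s hs
  exact hz.integral_eq s (Ioo_subset_Icc_self hs)

/-- With `m = z + (1 - s) v`, the product rule gives `(z / (1 - s))' = z / (1 - s)² + v / (1 - s) =
m / (1 - s)²`, which is integrated up to `t < 1`. -/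
lemma path_eq {x : E d} {z : ℝ → E d} (hz : IsRectifiedPath Ω p₀ p₁ x z) {t : ℝ}
    (ht : t ∈ Ico (0 : ℝ) 1) : z t =
    (1 - t) • (x + ∫ s in (0 : ℝ)..t, ((1 - s) ^ 2)⁻¹ • terminalMean Ω p₀ p₁ s (z s)) := by
  have hzc := H.continuousOn_path hz
  have hsub : Icc 0 t ⊆ Ico (0 : ℝ) 1 := fun s hs => ⟨hs.1, hs.2.trans_lt ht.2⟩
  have hpos : ∀ s ∈ Icc 0 t, 0 < 1 - s := fun s hs => by linarith [hs.2, ht.2]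
  have hm := H.continuousOn_terminalMean_comp (hzc.mono Ico_subset_Icc_self) hz.mem_interior
  have hFTC := intervalIntegral.integral_eq_sub_of_hasDerivAt_of_le ht.1
    (f := fun s => (1 - s)⁻¹ • z s)
    (f' := fun s => ((1 - s) ^ 2)⁻¹ • terminalMean Ω p₀ p₁ s (z s))
    (ContinuousOn.smul (ContinuousOn.inv₀ (by fun_prop) fun s hs => (hpos s hs).ne')
      (hzc.mono (hsub.trans Ico_subset_Icc_self))) (fun s hs => ?_)
    (ContinuousOn.intervalIntegrable (by rw [uIcc_of_le ht.1]; exact hm.mono hsub))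
  · have h0 : z 0 = x := by simpa using hz.integral_eq 0 (by simp)
    have h1 := hpos t (right_mem_Icc.2 ht.1)
    rw [hFTC]
    simp only [sub_zero, inv_one, one_smul, h0]
    rw [add_sub_cancel, smul_inv_smul₀ h1.ne']
  · have hs' : s ∈ Ioo (0 : ℝ) 1 := ⟨hs.1, hs.2.trans ht.2⟩
    have h1 : 0 < 1 - s := sub_pos.2 hs'.2
    have h2 : HasDerivAt (fun s => (1 - s)⁻¹ • z s) _ s :=
      (hasDerivAt_inv_one_sub h1.ne').smul (H.hasDerivAt_path hz hs')
    refine h2.congr_deriv ?_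
    have e : ((1 - s) ^ 2)⁻¹ * (1 - s) = (1 - s)⁻¹ := by field_simp
    rw [terminalMean, smul_add, smul_smul, e, add_comm]

/-- A rectified path started at distance `ρ` from the boundary has at time `t` at least the distance
`(1 - t) ρ` from it. -/
lemma closedBall_path_subset {x : E d} {z : ℝ → E d} {ρ t : ℝ}
    (hz : IsRectifiedPath Ω p₀ p₁ x z) (hx : Metric.closedBall x ρ ⊆ Ω) (ht : t ∈ Ico (0 : ℝ) 1) :
    Metric.closedBall (z t) ((1 - t) * ρ) ⊆ Ω := by
  have hsub : Icc 0 t ⊆ Ico (0 : ℝ) 1 := fun s hs => ⟨hs.1, hs.2.trans_lt ht.2⟩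
  have hm := H.continuousOn_terminalMean_comp
    ((H.continuousOn_path hz).mono Ico_subset_Icc_self) hz.mem_interior
  rw [H.path_eq hz ht]
  refine closedBall_subset_of_integral H.compact.isClosed H.convex hx ht.1 ht.2 (fun s hs => ?_)
    (ContinuousOn.intervalIntegrable (by rw [uIcc_of_le ht.1]; exact hm.mono hsub))
  exact H.terminalMean_mem ⟨hs.1, (hsub hs).2.le⟩ (hz.mem_interior s (hsub hs))

/-! ### Stability of rectified paths -/

/-- Two paths that keep a distance `ρ` from the boundary up to time `T` separate at most according
to Osgood's inequality. -/
lemma norm_path_sub_path_le (hd : 1 ≤ d) {a η ρ r T : ℝ} {x x' : E d} {z z' : ℝ → E d}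
    (ha : 0 < a) (hz : IsRectifiedPath Ω p₀ p₁ x z) (hz' : IsRectifiedPath Ω p₀ p₁ x' z')
    (hη : 0 < η) (hxx : ‖x - x'‖ ≤ η) (hρ : 0 < ρ) (hT : T ≤ 1)
    (hb : ∀ t ∈ Ico 0 T, Metric.closedBall (z t) ρ ⊆ Ω)
    (hb' : ∀ t ∈ Ico 0 T, Metric.closedBall (z' t) ρ ⊆ Ω) (hr : 0 < r)
    (hηr : Psi Ω p₀ p₁ a η +
      velocityConst d (Metric.diam Ω) (omegaInvOne Ω p₀ p₁) * (1 + 1 / ρ) ≤ Psi Ω p₀ p₁ a r) :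
    ∀ t ∈ Icc 0 T, ‖z t - z' t‖ ≤ r := by
  set A := velocityConst d (Metric.diam Ω) (omegaInvOne Ω p₀ p₁) * (1 + 1 / ρ) with hA
  have hA0 : 0 ≤ A := mul_nonneg (velocityConst_pos _ _ _).le (by positivity)
  have hsub : Icc 0 T ⊆ Icc (0 : ℝ) 1 := Icc_subset_Icc_right hT
  have hc : ContinuousOn (fun t => ‖z t - z' t‖) (Icc 0 T) :=
    (((H.continuousOn_path hz).mono hsub).sub ((H.continuousOn_path hz').mono hsub)).norm
  refine H.le_of_osgood ha hη hA0 hc (fun _ _ => norm_nonneg _) (fun t ht => ?_) hr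
    (by nlinarith)
  have hi : ∀ {x : E d} {z : ℝ → E d}, IsRectifiedPath Ω p₀ p₁ x z →
      IntervalIntegrable (fun s => velocity Ω p₀ p₁ s (z s)) volume 0 t := fun hz =>
    hz.integrable.mono_set (by
      rw [uIcc_of_le ht.1, uIcc_of_le zero_le_one]; exact Icc_subset_Icc_right (ht.2.trans hT))
  rw [hz.integral_eq t (hsub ht), hz'.integral_eq t (hsub ht), add_sub_add_comm,
    ← intervalIntegral.integral_sub (hi hz) (hi hz'), ← intervalIntegral.integral_const_mul]
  refine (norm_add_le _ _).trans (add_le_add hxx ?_)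
  refine (intervalIntegral.norm_integral_le_integral_norm ht.1).trans ?_
  refine intervalIntegral.integral_mono_on_of_le_Ioo ht.1 ((hi hz).sub (hi hz')).norm ?_ ?_
  · refine ContinuousOn.intervalIntegrable (continuousOn_const.mul ?_)
    rw [uIcc_of_le ht.1]
    exact H.continuous_add_omega.comp_continuousOn (hc.mono (Icc_subset_Icc_right ht.2))
  · intro s hs
    have hs' : s ∈ Ico 0 T := ⟨hs.1.le, hs.2.trans_le ht.2⟩
    exact H.norm_velocity_sub_le hd ⟨hs'.1, hs'.2.le.trans hT⟩ hρ (hb s hs') (hb' s hs')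

/-- Stability of rectified paths up to the final time: the motion after the time `1 - τ` is
estimated by the maximal speed. -/
lemma norm_path_sub_path_le_add (hd : 1 ≤ d) {a η ε τ r : ℝ} {x x' : E d} {z z' : ℝ → E d}
    (ha : 0 < a) (hz : IsRectifiedPath Ω p₀ p₁ x z) (hz' : IsRectifiedPath Ω p₀ p₁ x' z')
    (hη : 0 < η) (hxx : ‖x - x'‖ ≤ η) (hε : 0 < ε) (hx : Metric.closedBall x ε ⊆ Ω)
    (hx' : Metric.closedBall x' ε ⊆ Ω) (hτ : 0 < τ) (hτ1 : τ ≤ 1) (hr : 0 < r)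
    (hηr : Psi Ω p₀ p₁ a η + velocityConst d (Metric.diam Ω) (omegaInvOne Ω p₀ p₁) *
      (1 + 1 / (τ * ε)) ≤ Psi Ω p₀ p₁ a r) :
    ∀ t ∈ Icc (0 : ℝ) 1, ‖z t - z' t‖ ≤ r + 2 * Metric.diam Ω * τ := by
  have hball : ∀ {x : E d} {z : ℝ → E d}, IsRectifiedPath Ω p₀ p₁ x z →
      Metric.closedBall x ε ⊆ Ω → ∀ t ∈ Ico 0 (1 - τ), Metric.closedBall (z t) (τ * ε) ⊆ Ω := by
    intro x z hz hx t ht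
    refine (Metric.closedBall_subset_closedBall ?_).trans
      (H.closedBall_path_subset hz hx ⟨ht.1, by linarith [ht.2]⟩)
    have := ht.2
    gcongr
    linarith
  have hD : 0 ≤ Metric.diam Ω := Metric.diam_nonneg
  have key := H.norm_path_sub_path_le hd ha hz hz' hη hxx (mul_pos hτ hε)
    (by linarith : 1 - τ ≤ 1) (hball hz hx) (hball hz' hx') hr hηr
  intro t ht
  rcases le_total t (1 - τ) with h | h
  · have := key t ⟨ht.1, h⟩
    have : 0 ≤ 2 * Metric.diam Ω * τ := by positivity
    linarith
  · have hm : 1 - τ ∈ Icc (0 : ℝ) 1 := ⟨by linarith, by linarith⟩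
    have k1 := H.norm_path_sub_le hz hm ht
    have k2 := H.norm_path_sub_le hz' hm ht
    have k3 := key (1 - τ) ⟨hm.1, le_rfl⟩
    have k4 : |t - (1 - τ)| ≤ τ := by
      rw [abs_of_nonneg (by linarith)]
      linarith [ht.2]
    have k5 := mul_le_mul_of_nonneg_left k4 hD
    calc ‖z t - z' t‖ = ‖(z t - z (1 - τ)) + (z (1 - τ) - z' (1 - τ)) -
          (z' t - z' (1 - τ))‖ := by congr 1; module
      _ ≤ ‖z t - z (1 - τ)‖ + ‖z (1 - τ) - z' (1 - τ)‖ + ‖z' t - z' (1 - τ)‖ :=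
        (norm_sub_le _ _).trans (add_le_add_left (norm_add_le _ _) _)
      _ ≤ _ := by linarith

omit H in
lemma exists_Psi_add_le {a r : ℝ} (hO : Tendsto (Psi Ω p₀ p₁ a) (𝓝[>] 0) atBot) (Q : ℝ) :
    ∃ η > 0, Psi Ω p₀ p₁ a η + Q ≤ Psi Ω p₀ p₁ a r := by
  obtain ⟨η, h, h0⟩ := ((hO.eventually (eventually_le_atBot (Psi Ω p₀ p₁ a r - Q))).and
    self_mem_nhdsWithin).exists
  exact ⟨η, h0, by linarith⟩

/-- Rectified paths are equicontinuous with respect to their starting points. -/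
lemma exists_norm_path_sub_path_le (hd : 1 ≤ d) {a ε r : ℝ} (ha : 0 < a)
    (hO : Tendsto (Psi Ω p₀ p₁ a) (𝓝[>] 0) atBot) (hε : 0 < ε) (hr : 0 < r) :
    ∃ η > 0, ∀ (x x' : E d) (z z' : ℝ → E d), IsRectifiedPath Ω p₀ p₁ x z →
      IsRectifiedPath Ω p₀ p₁ x' z' → Metric.closedBall x ε ⊆ Ω → Metric.closedBall x' ε ⊆ Ω →
      ‖x - x'‖ ≤ η → ∀ t ∈ Icc (0 : ℝ) 1, ‖z t - z' t‖ ≤ r := by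
  have hD := H.diam_pos hd
  -- The motion after time `1 - τ` then costs at most `r / 2`, leaving `r / 2` for Osgood's
  -- inequality.
  set τ := min 1 (r / (4 * Metric.diam Ω)) with hτ
  have hτ0 : 0 < τ := lt_min one_pos (by positivity)
  have hτ2 : 2 * Metric.diam Ω * τ ≤ r / 2 := by
    calc _ ≤ 2 * Metric.diam Ω * (r / (4 * Metric.diam Ω)) := by
          gcongr
          exact min_le_right _ _
      _ = r / 2 := by field_simp; ring
  obtain ⟨η, hη, h⟩ := exists_Psi_add_le (r := r / 2) hO
    (velocityConst d (Metric.diam Ω) (omegaInvOne Ω p₀ p₁) * (1 + 1 / (τ * ε)))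
  refine ⟨η, hη, fun x x' z z' hz hz' hx hx' hxx t ht => ?_⟩
  have := H.norm_path_sub_path_le_add hd ha hz hz' hη hxx hε hx hx' hτ0 (min_le_left _ _)
    (half_pos hr) h t ht
  linarith

/-- Equal starting points are within every `η`, so the paths are within every `r > 0` of each other.
-/
lemma path_unique (hd : 1 ≤ d) {a : ℝ} {x : E d} {z z' : ℝ → E d} (ha : 0 < a)
    (hO : Tendsto (Psi Ω p₀ p₁ a) (𝓝[>] 0) atBot) (hx : x ∈ interior Ω)
    (hz : IsRectifiedPath Ω p₀ p₁ x z) (hz' : IsRectifiedPath Ω p₀ p₁ x z') :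
    ∀ t ∈ Icc (0 : ℝ) 1, z t = z' t := by
  intro t ht
  obtain ⟨ε, hε, hxε⟩ := exists_closedBall_subset hx
  rw [← sub_eq_zero, ← norm_le_zero_iff]
  refine le_of_forall_pos_le_add fun r hr => ?_
  obtain ⟨η, hη, h⟩ := H.exists_norm_path_sub_path_le hd ha hO hε hr
  rw [zero_add]
  exact h x x z z' hz hz' hxε hxε (by simpa using hη.le) t ht

/-! ### Existence of rectified paths -/

/-- The limit `v` of the decreasing majorants satisfies `v ≤ G = K ∫ (v + ω(v))`. As `v` is merely
measurable, Osgood's inequality is applied to the continuous function `G`, which satisfies `G ≤ K ∫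
(G + ω(G))`; letting the initial bound `η` be as small as needed gives `G ≤ r` for every `r > 0`. -/
lemma tendsto_majorant_zero {a K T : ℝ} (ha : 0 < a)
    (hO : Tendsto (Psi Ω p₀ p₁ a) (𝓝[>] 0) atBot) (hK : 0 ≤ K) {u : ℕ → ℝ → ℝ}
    (hc : ∀ n, Continuous (u n)) (h0 : ∀ n, ∀ t ∈ Icc 0 T, 0 ≤ u n t)
    (hanti : ∀ t ∈ Icc 0 T, Antitone fun n => u n t) {B : ℝ} (hB : ∀ t ∈ Icc 0 T, u 0 t ≤ B)
    (hstep : ∀ n, ∀ t ∈ Icc 0 T,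
      u (n + 1) t ≤ K * ∫ s in (0 : ℝ)..t, (u n s + omega Ω p₀ p₁ (u n s))) :
    ∀ t ∈ Icc 0 T, Tendsto (fun n => u n t) atTop (𝓝 0) := by
  set v : ℝ → ℝ := fun t => ⨅ n, u n t with hv
  have hlim : ∀ t ∈ Icc 0 T, Tendsto (fun n => u n t) atTop (𝓝 (v t)) := fun t ht =>
    tendsto_atTop_ciInf (hanti t ht) ⟨0, by rintro _ ⟨n, rfl⟩; exact h0 n t ht⟩
  have hv0 : ∀ t ∈ Icc 0 T, 0 ≤ v t := fun t ht => ge_of_tendsto' (hlim t ht) fun n => h0 n t ht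
  have hvB : ∀ t ∈ Icc 0 T, v t ≤ B := fun t ht =>
    (le_of_tendsto' (hlim t ht) fun n => hanti t ht (Nat.zero_le n)).trans (hB t ht)
  have hφ := H.continuous_add_omega
  have hφlim : ∀ t ∈ Icc 0 T, Tendsto (fun n => u n t + omega Ω p₀ p₁ (u n t)) atTop
      (𝓝 (v t + omega Ω p₀ p₁ (v t))) := fun t ht => (hφ.tendsto (v t)).comp (hlim t ht)
  have hbound : ∀ w, 0 ≤ w → w ≤ B → ‖w + omega Ω p₀ p₁ w‖ ≤ B + omega Ω p₀ p₁ B := by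
    intro w hw hwB
    rw [Real.norm_of_nonneg (add_nonneg hw (omega_nonneg w))]
    exact H.add_omega_mono hwB
  have hmemIoc : ∀ {t s : ℝ}, t ∈ Icc 0 T → s ∈ uIoc 0 t → s ∈ Icc 0 T := by
    intro t s ht hs
    rw [uIoc_of_le ht.1] at hs
    exact ⟨hs.1.le, hs.2.trans ht.2⟩
  have hmeas : ∀ t ∈ Icc 0 T, AEStronglyMeasurable (fun s => v s + omega Ω p₀ p₁ (v s))
      (volume.restrict (uIoc 0 t)) := fun t ht =>
    aestronglyMeasurable_of_tendsto_ae atTop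
      (fun n => (hφ.comp (hc n)).aestronglyMeasurable) (by
        filter_upwards [ae_restrict_mem measurableSet_uIoc] with s hs
        exact hφlim s (hmemIoc ht hs))
  have hint : ∀ t ∈ Icc 0 T,
      IntervalIntegrable (fun s => v s + omega Ω p₀ p₁ (v s)) volume 0 t := by
    intro t ht
    refine (intervalIntegrable_const (c := B + omega Ω p₀ p₁ B)).mono_fun' (hmeas t ht) ?_
    filter_upwards [ae_restrict_mem measurableSet_uIoc] with s hs
    exact hbound _ (hv0 s (hmemIoc ht hs)) (hvB s (hmemIoc ht hs))
  set G : ℝ → ℝ := fun t => K * ∫ s in (0 : ℝ)..t, (v s + omega Ω p₀ p₁ (v s)) with hG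
  have hvG : ∀ t ∈ Icc 0 T, v t ≤ G t := by
    intro t ht
    have h1 : Tendsto (fun n => K * ∫ s in (0 : ℝ)..t, (u n s + omega Ω p₀ p₁ (u n s))) atTop
        (𝓝 (G t)) := by
      refine Tendsto.const_mul _ (intervalIntegral.tendsto_integral_filter_of_dominated_convergence
        (fun _ => B + omega Ω p₀ p₁ B)
        (Eventually.of_forall fun n => (hφ.comp (hc n)).aestronglyMeasurable)
        (Eventually.of_forall fun n => Eventually.of_forall fun s hs => ?_)
        intervalIntegrable_const (Eventually.of_forall fun s hs => hφlim s (hmemIoc ht hs)))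
      exact hbound _ (h0 n s (hmemIoc ht hs)) ((hanti s (hmemIoc ht hs) (Nat.zero_le n)).trans
        (hB s (hmemIoc ht hs)))
    exact le_of_tendsto_of_tendsto' ((tendsto_add_atTop_iff_nat 1).2 (hlim t ht)) h1
      fun n => hstep n t ht
  have hGc : ContinuousOn G (Icc 0 T) := by
    rcases le_or_gt 0 T with hT | hT
    · have := intervalIntegral.continuousOn_primitive_interval (μ := volume) (a := 0) (b := T)
        (f := fun s => v s + omega Ω p₀ p₁ (v s)) (by
          rw [uIcc_of_le hT, integrableOn_Icc_iff_integrableOn_Ioc]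
          exact (intervalIntegrable_iff_integrableOn_Ioc_of_le hT).1 (hint T ⟨hT, le_rfl⟩))
      rw [uIcc_of_le hT] at this
      exact continuousOn_const.mul this
    · rw [Icc_eq_empty (not_le.2 hT)]
      exact continuousOn_empty _
  have hGG : ∀ t ∈ Icc 0 T, G t ≤ K * ∫ s in (0 : ℝ)..t, (G s + omega Ω p₀ p₁ (G s)) := by
    intro t ht
    refine mul_le_mul_of_nonneg_left (intervalIntegral.integral_mono_on ht.1 (hint t ht) ?_ ?_) hK
    · refine ContinuousOn.intervalIntegrable ?_
      rw [uIcc_of_le ht.1]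
      exact hφ.comp_continuousOn (hGc.mono (Icc_subset_Icc_right ht.2))
    · exact fun s hs => H.add_omega_mono (hvG s ⟨hs.1, hs.2.trans ht.2⟩)
  intro t ht
  have hvt : v t = 0 := by
    refine le_antisymm (le_of_forall_pos_le_add fun r hr => ?_) (hv0 t ht)
    obtain ⟨η, hη, h⟩ := exists_Psi_add_le (r := r) hO (K * T)
    rw [zero_add]
    refine (hvG t ht).trans (H.le_of_osgood ha hη hK hGc
      (fun s hs => (hv0 s hs).trans (hvG s hs)) (fun s hs => ?_) hr h t ht)
    linarith [hGG s hs]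
  rw [← hvt]
  exact hlim t ht

end Admissible

/-- The fixed points of this operator are the rectified paths. It maps all paths in `Ω` to paths
that keep a distance from the boundary. -/
def picardStep (Ω : Set (E d)) (p₀ p₁ : E d → ℝ) (x : E d) (w : ℝ → E d) (t : ℝ) : E d :=
  (1 - t) • (x + ∫ s in (0 : ℝ)..t, ((1 - s) ^ 2)⁻¹ • terminalMean Ω p₀ p₁ s (w s))

/-- The Picard iterates of the constant path. -/
def picardIter (Ω : Set (E d)) (p₀ p₁ : E d → ℝ) (x : E d) : ℕ → ℝ → E d
  | 0 => fun _ => x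
  | n + 1 => picardStep Ω p₀ p₁ x (picardIter Ω p₀ p₁ x n)

lemma continuousOn_picardStep {x : E d} {w : ℝ → E d}
    (hi : ∀ t ∈ Ico (0 : ℝ) 1, IntervalIntegrable
      (fun s => ((1 - s) ^ 2)⁻¹ • terminalMean Ω p₀ p₁ s (w s)) volume 0 t) :
    ContinuousOn (picardStep Ω p₀ p₁ x w) (Ico 0 1) := by
  intro t ht
  set T := (1 + t) / 2 with hT
  have hT1 : T < 1 := by linarith [ht.2]
  have htT : t < T := by linarith [ht.2]
  have hT0 : 0 ≤ T := ht.1.trans htT.le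
  have hc : ContinuousOn (picardStep Ω p₀ p₁ x w) (Icc 0 T) := by
    have := intervalIntegral.continuousOn_primitive_interval (μ := volume) (a := 0) (b := T)
      (f := fun s => ((1 - s) ^ 2)⁻¹ • terminalMean Ω p₀ p₁ s (w s)) (by
        rw [uIcc_of_le hT0, integrableOn_Icc_iff_integrableOn_Ioc]
        exact (intervalIntegrable_iff_integrableOn_Ioc_of_le hT0).1 (hi T ⟨hT0, hT1⟩))
    rw [uIcc_of_le hT0] at this
    exact (by fun_prop : ContinuousOn (fun s : ℝ => 1 - s) (Icc 0 T)).smul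
      (continuousOn_const.add this)
  refine (hc t ⟨ht.1, htT.le⟩).mono_of_mem_nhdsWithin ?_
  filter_upwards [self_mem_nhdsWithin, mem_nhdsWithin_of_mem_nhds (Iio_mem_nhds htT)] with s h1 h2
  exact ⟨h1.1, h2.le⟩

namespace Admissible

variable (H : Admissible Ω p₀ p₁)
include H

lemma intervalIntegrable_terminalMean {w : ℝ → E d} (hc : ContinuousOn w (Ico 0 1))
    (hw : ∀ t ∈ Ico (0 : ℝ) 1, w t ∈ interior Ω) {t : ℝ} (ht : t ∈ Ico (0 : ℝ) 1) :
    IntervalIntegrable (fun s => ((1 - s) ^ 2)⁻¹ • terminalMean Ω p₀ p₁ s (w s)) volume 0 t := by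
  refine ContinuousOn.intervalIntegrable ((H.continuousOn_terminalMean_comp hc hw).mono ?_)
  rw [uIcc_of_le ht.1]
  exact fun s hs => ⟨hs.1, hs.2.trans_lt ht.2⟩

omit H in
lemma mem_interior_of_closedBall_mul {w : ℝ → E d} {ρ : ℝ} (hρ : 0 < ρ)
    (hw : ∀ t ∈ Ico (0 : ℝ) 1, Metric.closedBall (w t) ((1 - t) * ρ) ⊆ Ω) :
    ∀ t ∈ Ico (0 : ℝ) 1, w t ∈ interior Ω := fun t ht =>
  mem_interior_of_closedBall (mul_pos (sub_pos.2 ht.2) hρ) (hw t ht)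

lemma picardIter_spec {x : E d} {ρ : ℝ} (hρ : 0 < ρ) (hx : Metric.closedBall x ρ ⊆ Ω) (n : ℕ) :
    ContinuousOn (picardIter Ω p₀ p₁ x n) (Ico 0 1) ∧
      ∀ t ∈ Ico (0 : ℝ) 1, Metric.closedBall (picardIter Ω p₀ p₁ x n t) ((1 - t) * ρ) ⊆ Ω := by
  induction n with
  | zero =>
    refine ⟨continuousOn_const, fun t ht => (Metric.closedBall_subset_closedBall ?_).trans hx⟩
    nlinarith [ht.1]
  | succ n ih =>
    have hint := mem_interior_of_closedBall_mul hρ ih.2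
    refine ⟨continuousOn_picardStep fun t ht => H.intervalIntegrable_terminalMean ih.1 hint ht,
      fun t ht => ?_⟩
    exact closedBall_subset_of_integral H.compact.isClosed H.convex hx ht.1 ht.2
      (fun s hs => H.terminalMean_mem ⟨hs.1, hs.2.trans ht.2.le⟩
        (hint s ⟨hs.1, hs.2.trans_lt ht.2⟩)) (H.intervalIntegrable_terminalMean ih.1 hint ht)

lemma norm_terminalMean_sub_le (hd : 1 ≤ d) {ρ T s : ℝ} {y y' : E d} (hρ : 0 < ρ) (hT : T < 1)
    (hs : s ∈ Icc 0 T) (hy : Metric.closedBall y ((1 - s) * ρ) ⊆ Ω)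
    (hy' : Metric.closedBall y' ((1 - s) * ρ) ⊆ Ω) :
    ‖((1 - s) ^ 2)⁻¹ • terminalMean Ω p₀ p₁ s y - ((1 - s) ^ 2)⁻¹ • terminalMean Ω p₀ p₁ s y'‖ ≤
      ((1 - T) ^ 2)⁻¹ * (1 + velocityConst d (Metric.diam Ω) (omegaInvOne Ω p₀ p₁) *
        (1 + 1 / ((1 - T) * ρ))) * (‖y - y'‖ + omega Ω p₀ p₁ ‖y - y'‖) := by
  set A := velocityConst d (Metric.diam Ω) (omegaInvOne Ω p₀ p₁)
  have hA := velocityConst_pos d (Metric.diam Ω) (omegaInvOne Ω p₀ p₁)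
  have hT' : 0 < 1 - T := sub_pos.2 hT
  have hTs : 1 - T ≤ 1 - s := by linarith [hs.2]
  have hs1 : 0 < 1 - s := hT'.trans_le hTs
  have hω := omega_nonneg (Ω := Ω) (p₀ := p₀) (p₁ := p₁) ‖y - y'‖
  have hv := H.norm_velocity_sub_le hd (t := s) (ρ := (1 - T) * ρ) (z := y) (z' := y')
    ⟨hs.1, by linarith⟩ (by positivity)
    ((Metric.closedBall_subset_closedBall (by gcongr)).trans hy)
    ((Metric.closedBall_subset_closedBall (by gcongr)).trans hy')
  have hn := norm_nonneg (velocity Ω p₀ p₁ s y - velocity Ω p₀ p₁ s y')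
  rw [← smul_sub, norm_smul, Real.norm_of_nonneg (by positivity), mul_assoc]
  gcongr
  calc ‖terminalMean Ω p₀ p₁ s y - terminalMean Ω p₀ p₁ s y'‖
      = ‖(y - y') + (1 - s) • (velocity Ω p₀ p₁ s y - velocity Ω p₀ p₁ s y')‖ := by
        congr 1; simp only [terminalMean]; module
    _ ≤ ‖y - y'‖ + (1 - s) * ‖velocity Ω p₀ p₁ s y - velocity Ω p₀ p₁ s y'‖ := by
        refine (norm_add_le _ _).trans ?_
        rw [norm_smul, Real.norm_of_nonneg hs1.le]
    _ ≤ ‖y - y'‖ + 1 * ‖velocity Ω p₀ p₁ s y - velocity Ω p₀ p₁ s y'‖ := by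
        gcongr; linarith [hs.1]
    _ ≤ _ := by linarith

lemma norm_picardStep_sub_le (hd : 1 ≤ d) {x : E d} {ρ T : ℝ} {w w' : ℝ → E d} (hρ : 0 < ρ)
    (hT : T < 1) (hc : ContinuousOn w (Ico 0 1)) (hc' : ContinuousOn w' (Ico 0 1))
    (hw : ∀ t ∈ Ico (0 : ℝ) 1, Metric.closedBall (w t) ((1 - t) * ρ) ⊆ Ω)
    (hw' : ∀ t ∈ Ico (0 : ℝ) 1, Metric.closedBall (w' t) ((1 - t) * ρ) ⊆ Ω) {t : ℝ}
    (ht : t ∈ Icc 0 T) :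
    ‖picardStep Ω p₀ p₁ x w t - picardStep Ω p₀ p₁ x w' t‖ ≤
      ((1 - T) ^ 2)⁻¹ * (1 + velocityConst d (Metric.diam Ω) (omegaInvOne Ω p₀ p₁) *
        (1 + 1 / ((1 - T) * ρ))) *
        ∫ s in (0 : ℝ)..t, (‖w s - w' s‖ + omega Ω p₀ p₁ ‖w s - w' s‖) := by
  have ht1 : t ∈ Ico (0 : ℝ) 1 := ⟨ht.1, ht.2.trans_lt hT⟩
  have hi := H.intervalIntegrable_terminalMean hc (mem_interior_of_closedBall_mul hρ hw) ht1
  have hi' := H.intervalIntegrable_terminalMean hc' (mem_interior_of_closedBall_mul hρ hw') ht1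
  rw [picardStep, picardStep, ← smul_sub, add_sub_add_left_eq_sub,
    ← intervalIntegral.integral_sub hi hi', norm_smul, Real.norm_of_nonneg (sub_nonneg.2 ht1.2.le),
    ← intervalIntegral.integral_const_mul]
  refine (mul_le_of_le_one_left (norm_nonneg _) (by linarith [ht.1])).trans ?_
  refine (intervalIntegral.norm_integral_le_integral_norm ht.1).trans ?_
  refine intervalIntegral.integral_mono_on ht.1 (hi.sub hi').norm ?_ ?_
  · refine ContinuousOn.intervalIntegrable (continuousOn_const.mul ?_)
    rw [uIcc_of_le ht.1]
    exact H.continuous_add_omega.comp_continuousOn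
      ((hc.sub hc').norm.mono fun s hs => ⟨hs.1, hs.2.trans_lt ht1.2⟩)
  · intro s hs
    have hs1 : s ∈ Ico (0 : ℝ) 1 := ⟨hs.1, hs.2.trans_lt ht1.2⟩
    exact H.norm_terminalMean_sub_le hd hρ hT ⟨hs.1, hs.2.trans ht.2⟩ (hw s hs1) (hw' s hs1)


/-- The modulus `h + ω(h)` need not make the Picard operator a contraction. Instead `u n` dominates
all differences of iterates with index at least `n`, and tends to zero by `tendsto_majorant_zero`;
so the iterates are Cauchy. -/
lemma exists_tendsto_picardIter (hd : 1 ≤ d) {a ρ : ℝ} {x : E d} (ha : 0 < a)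
    (hO : Tendsto (Psi Ω p₀ p₁ a) (𝓝[>] 0) atBot) (hρ : 0 < ρ)
    (hx : Metric.closedBall x ρ ⊆ Ω) {t : ℝ} (ht : t ∈ Ico (0 : ℝ) 1) :
    ∃ l, Tendsto (fun n => picardIter Ω p₀ p₁ x n t) atTop (𝓝 l) := by
  set K := ((1 - t) ^ 2)⁻¹ * (1 + velocityConst d (Metric.diam Ω) (omegaInvOne Ω p₀ p₁) *
        (1 + 1 / ((1 - t) * ρ))) with hKdef
  have ht' : 0 < 1 - t := sub_pos.2 ht.2
  have hK : 0 ≤ K := by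
    have := velocityConst_pos d (Metric.diam Ω) (omegaInvOne Ω p₀ p₁)
    positivity
  have hD : 0 ≤ Metric.diam Ω := Metric.diam_nonneg
  have hφ := H.continuous_add_omega
  -- The minimum with `diam Ω` gives `u 1 ≤ u 0`; monotonicity of `s + ω(s)` then propagates the
  -- decrease to all `n`.
  let u : ℕ → ℝ → ℝ := fun n => Nat.rec (fun _ => Metric.diam Ω)
    (fun _ f s => min (Metric.diam Ω) (K * ∫ r in (0 : ℝ)..s, (f r + omega Ω p₀ p₁ (f r)))) n
  have hu : ∀ n s, u (n + 1) s =
    min (Metric.diam Ω) (K * ∫ r in (0 : ℝ)..s, (u n r + omega Ω p₀ p₁ (u n r))) := fun _ _ => rfl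
  have hc : ∀ n, Continuous (u n) := by
    intro n
    induction n with
    | zero => exact continuous_const
    | succ n ih =>
      exact continuous_const.min (continuous_const.mul (intervalIntegral.continuous_primitive
        (fun _ _ => (hφ.comp ih).intervalIntegrable _ _) 0))
  have hint : ∀ n s, IntervalIntegrable (fun r => u n r + omega Ω p₀ p₁ (u n r)) volume 0 s :=
    fun n s => (hφ.comp (hc n)).intervalIntegrable _ _
  have h0 : ∀ n, ∀ s ∈ Icc 0 t, 0 ≤ u n s := by
    intro n
    induction n with
    | zero => exact fun _ _ => hD
    | succ n ih =>
      intro s hs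
      refine le_min hD (mul_nonneg hK (intervalIntegral.integral_nonneg hs.1 fun r hr => ?_))
      exact add_nonneg (ih r ⟨hr.1, hr.2.trans hs.2⟩) (omega_nonneg _)
  have hanti : ∀ n, ∀ s ∈ Icc 0 t, u (n + 1) s ≤ u n s := by
    intro n
    induction n with
    | zero => exact fun s _ => min_le_left _ _
    | succ n ih =>
      intro s hs
      rw [hu (n + 1), hu n]
      refine min_le_min_left _ (mul_le_mul_of_nonneg_left
        (intervalIntegral.integral_mono_on hs.1 (hint (n + 1) s) (hint n s) fun r hr => ?_) hK)
      exact H.add_omega_mono (ih r ⟨hr.1, hr.2.trans hs.2⟩)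
  have hlim := H.tendsto_majorant_zero ha hO hK hc h0
    (fun s hs => antitone_nat_of_succ_le fun n => hanti n s hs) (B := Metric.diam Ω)
    (fun _ _ => le_rfl) (fun n s _ => (hu n s).trans_le (min_le_right _ _)) t ⟨ht.1, le_rfl⟩
  have hz := H.picardIter_spec hρ hx
  have hdist : ∀ n j k, ∀ s ∈ Icc 0 t,
      ‖picardIter Ω p₀ p₁ x (n + j) s - picardIter Ω p₀ p₁ x (n + k) s‖ ≤ u n s := by
    have hdiam : ∀ m m', ∀ s ∈ Icc 0 t,
        ‖picardIter Ω p₀ p₁ x m s - picardIter Ω p₀ p₁ x m' s‖ ≤ Metric.diam Ω := by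
      intro m m' s hs
      have hs1 : s ∈ Ico (0 : ℝ) 1 := ⟨hs.1, hs.2.trans_lt ht.2⟩
      have hs0 : 0 ≤ (1 - s) * ρ := mul_nonneg (sub_nonneg.2 hs1.2.le) hρ.le
      rw [← dist_eq_norm]
      exact Metric.dist_le_diam_of_mem H.compact.isBounded
        ((hz m).2 s hs1 (Metric.mem_closedBall_self hs0))
        ((hz m').2 s hs1 (Metric.mem_closedBall_self hs0))
    intro n
    induction n with
    | zero => exact fun j k s hs => hdiam _ _ s hs
    | succ n ih =>
      intro j k s hs
      rw [hu]
      refine le_min (hdiam _ _ s hs) ?_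
      rw [Nat.add_right_comm n 1 j, Nat.add_right_comm n 1 k]
      refine (H.norm_picardStep_sub_le hd hρ ht.2 (hz _).1 (hz _).1 (hz _).2 (hz _).2 hs).trans
        (mul_le_mul_of_nonneg_left ?_ hK)
      refine intervalIntegral.integral_mono_on hs.1 ?_ (hint _ _) fun r hr =>
        H.add_omega_mono (ih j k r ⟨hr.1, hr.2.trans hs.2⟩)
      refine ContinuousOn.intervalIntegrable ?_
      rw [uIcc_of_le hs.1]
      exact hφ.comp_continuousOn (((hz _).1.sub (hz _).1).norm.mono fun r hr =>
        ⟨hr.1, (hr.2.trans hs.2).trans_lt ht.2⟩)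
  refine cauchySeq_tendsto_of_complete (cauchySeq_of_le_tendsto_0 (fun n => u n t) ?_ hlim)
  intro m m' n hm hm'
  obtain ⟨j, rfl⟩ := Nat.exists_eq_add_of_le hm
  obtain ⟨k, rfl⟩ := Nat.exists_eq_add_of_le hm'
  rw [dist_eq_norm]
  exact hdist n j k t ⟨ht.1, le_rfl⟩

/-- A fixed point of the Picard operator. -/
lemma exists_picardStep_eq (hd : 1 ≤ d) {a ρ : ℝ} {x : E d} (ha : 0 < a)
    (hO : Tendsto (Psi Ω p₀ p₁ a) (𝓝[>] 0) atBot) (hρ : 0 < ρ)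
    (hx : Metric.closedBall x ρ ⊆ Ω) :
    ∃ z : ℝ → E d, ContinuousOn z (Ico 0 1) ∧ (∀ t ∈ Ico (0 : ℝ) 1, z t ∈ interior Ω) ∧
      ∀ t ∈ Ico (0 : ℝ) 1, z t = picardStep Ω p₀ p₁ x z t := by
  have hex : ∀ t, ∃ l, t ∈ Ico (0 : ℝ) 1 →
      Tendsto (fun n => picardIter Ω p₀ p₁ x n t) atTop (𝓝 l) := by
    intro t
    by_cases ht : t ∈ Ico (0 : ℝ) 1
    · obtain ⟨l, hl⟩ := H.exists_tendsto_picardIter hd ha hO hρ hx ht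
      exact ⟨l, fun _ => hl⟩
    · exact ⟨0, fun h => absurd h ht⟩
  choose z hz using hex
  have hspec := H.picardIter_spec hρ hx
  have hball : ∀ t ∈ Ico (0 : ℝ) 1, Metric.closedBall (z t) ((1 - t) * ρ) ⊆ Ω := by
    intro t ht b hb
    have h1 : Tendsto (fun n => b + (picardIter Ω p₀ p₁ x n t - z t)) atTop (𝓝 b) := by
      simpa using ((hz t ht).sub_const (z t)).const_add b
    refine H.compact.isClosed.mem_of_tendsto h1 (Eventually.of_forall fun n => (hspec n).2 t ht ?_)
    rw [Metric.mem_closedBall, dist_eq_norm] at hb ⊢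
    convert hb using 2
    module
  have hint := mem_interior_of_closedBall_mul hρ hball
  have hintn := fun n => mem_interior_of_closedBall_mul hρ (hspec n).2
  obtain ⟨C, hC⟩ := H.compact.isBounded.subset_closedBall (0 : E d)
  have hC0 : 0 ≤ C := by
    have h := hC (hx (Metric.mem_closedBall_self hρ.le))
    rw [mem_closedBall_zero_iff] at h
    exact (norm_nonneg _).trans h
  have hmemIoc : ∀ {t s : ℝ}, t ∈ Ico (0 : ℝ) 1 → s ∈ uIoc 0 t → s ∈ Ico (0 : ℝ) 1 := by
    intro t s ht hs
    rw [uIoc_of_le ht.1] at hs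
    exact ⟨hs.1.le, hs.2.trans_lt ht.2⟩
  have hbound : ∀ {t s : ℝ} {y : E d}, t ∈ Ico (0 : ℝ) 1 → s ∈ uIoc 0 t → y ∈ interior Ω →
      ‖((1 - s) ^ 2)⁻¹ • terminalMean Ω p₀ p₁ s y‖ ≤ ((1 - t) ^ 2)⁻¹ * C := by
    intro t s y ht hs hy
    have hs1 := hmemIoc ht hs
    have h1 : 0 < 1 - t := sub_pos.2 ht.2
    have h2 : 0 < 1 - s := sub_pos.2 hs1.2
    have h3 := hC (H.terminalMean_mem ⟨hs1.1, hs1.2.le⟩ hy)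
    rw [mem_closedBall_zero_iff] at h3
    rw [uIoc_of_le ht.1] at hs
    have h4 := hs.2
    rw [norm_smul, Real.norm_of_nonneg (by positivity)]
    gcongr
  have hlim : ∀ s ∈ Ico (0 : ℝ) 1, Tendsto
      (fun n => ((1 - s) ^ 2)⁻¹ • terminalMean Ω p₀ p₁ s (picardIter Ω p₀ p₁ x n s)) atTop
      (𝓝 (((1 - s) ^ 2)⁻¹ • terminalMean Ω p₀ p₁ s (z s))) := by
    intro s hs
    have h1 := (H.continuousAt_velocity ⟨hs.1, hs.2.le⟩ (hint s hs)).tendsto.comp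
      (tendsto_const_nhds.prodMk_nhds (hz s hs))
    exact ((hz s hs).add (h1.const_smul (1 - s))).const_smul _
  have hmeasn : ∀ n, ∀ t ∈ Ico (0 : ℝ) 1, AEStronglyMeasurable
      (fun s => ((1 - s) ^ 2)⁻¹ • terminalMean Ω p₀ p₁ s (picardIter Ω p₀ p₁ x n s))
      (volume.restrict (uIoc 0 t)) := fun n t ht =>
    (intervalIntegrable_iff.1
      (H.intervalIntegrable_terminalMean (hspec n).1 (hintn n) ht)).aestronglyMeasurable
  have hi : ∀ t ∈ Ico (0 : ℝ) 1, IntervalIntegrable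
      (fun s => ((1 - s) ^ 2)⁻¹ • terminalMean Ω p₀ p₁ s (z s)) volume 0 t := by
    intro t ht
    refine (intervalIntegrable_const (c := ((1 - t) ^ 2)⁻¹ * C)).mono_fun'
      (aestronglyMeasurable_of_tendsto_ae atTop (fun n => hmeasn n t ht) ?_) ?_
    · filter_upwards [ae_restrict_mem measurableSet_uIoc] with s hs using hlim s (hmemIoc ht hs)
    · filter_upwards [ae_restrict_mem measurableSet_uIoc] with s hs
      exact hbound ht hs (hint s (hmemIoc ht hs))
  have hfix : ∀ t ∈ Ico (0 : ℝ) 1, z t = picardStep Ω p₀ p₁ x z t := by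
    intro t ht
    refine tendsto_nhds_unique ((tendsto_add_atTop_iff_nat 1).2 (hz t ht)) ?_
    refine Tendsto.const_smul (Tendsto.const_add _
      (intervalIntegral.tendsto_integral_filter_of_dominated_convergence
        (fun _ => ((1 - t) ^ 2)⁻¹ * C) (Eventually.of_forall fun n => hmeasn n t ht)
        (Eventually.of_forall fun n => Eventually.of_forall fun s hs =>
          hbound ht hs (hintn n s (hmemIoc ht hs)))
        intervalIntegrable_const (Eventually.of_forall fun s hs => hlim s (hmemIoc ht hs)))) _
  exact ⟨z, (continuousOn_picardStep hi).congr hfix, hint, hfix⟩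

/-- The converse of `path_eq`: differentiating the fixed point equation gives `-z / (1 - s) + m / (1
- s) = v`. -/
lemma integral_velocity_of_picardStep_eq {x : E d} {z : ℝ → E d} (hc : ContinuousOn z (Ico 0 1))
    (hint : ∀ t ∈ Ico (0 : ℝ) 1, z t ∈ interior Ω)
    (hfix : ∀ t ∈ Ico (0 : ℝ) 1, z t = picardStep Ω p₀ p₁ x z t) {t : ℝ}
    (ht : t ∈ Ico (0 : ℝ) 1) : z t = x + ∫ s in (0 : ℝ)..t, velocity Ω p₀ p₁ s (z s) := by
  have hsub : Icc 0 t ⊆ Ico (0 : ℝ) 1 := fun s hs => ⟨hs.1, hs.2.trans_lt ht.2⟩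
  have hv := H.continuousOn_velocity_comp hc hint
  have hm := (H.continuousOn_terminalMean_comp hc hint).mono Ioo_subset_Ico_self
  rw [intervalIntegral.integral_eq_sub_of_hasDerivAt_of_le ht.1 (f := z) (hc.mono hsub)
    (fun s hs => ?_)
    (ContinuousOn.intervalIntegrable (by rw [uIcc_of_le ht.1]; exact hv.mono hsub))]
  · have h0 : z 0 = x := by
      rw [hfix 0 (by simp), picardStep]
      simp
    rw [h0, add_sub_cancel]
  · have hs1 : s ∈ Ioo (0 : ℝ) 1 := ⟨hs.1, hs.2.trans ht.2⟩
    have hs' := Ioo_subset_Ico_self hs1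
    have h1 : 0 < 1 - s := sub_pos.2 hs1.2
    have hI : HasDerivAt
        (fun t => x + ∫ s in (0 : ℝ)..t, ((1 - s) ^ 2)⁻¹ • terminalMean Ω p₀ p₁ s (z s))
        (((1 - s) ^ 2)⁻¹ • terminalMean Ω p₀ p₁ s (z s)) s :=
      HasDerivAt.const_add _ (intervalIntegral.integral_hasDerivAt_right
        (H.intervalIntegrable_terminalMean hc hint hs')
        (hm.stronglyMeasurableAtFilter isOpen_Ioo _ hs1)
        (hm.continuousAt (isOpen_Ioo.mem_nhds hs1)))
    have h2 : HasDerivAt (picardStep Ω p₀ p₁ x z) _ s := ((hasDerivAt_id s).const_sub 1).smul hI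
    have h3 : z s = (1 - s) • (x + ∫ r in (0 : ℝ)..s,
      ((1 - r) ^ 2)⁻¹ • terminalMean Ω p₀ p₁ r (z r)) := hfix s hs'
    have h4 : x + ∫ r in (0 : ℝ)..s, ((1 - r) ^ 2)⁻¹ • terminalMean Ω p₀ p₁ r (z r) =
        (1 - s)⁻¹ • z s := by rw [h3, inv_smul_smul₀ h1.ne']
    have h5 : HasDerivAt (picardStep Ω p₀ p₁ x z) (velocity Ω p₀ p₁ s (z s)) s := by
      refine h2.congr_deriv ?_
      rw [h4]
      simp only [id, terminalMean, smul_add, smul_smul]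
      have e1 : (1 - s) * ((1 - s) ^ 2)⁻¹ = (1 - s)⁻¹ := by field_simp
      have e2 : (1 - s) * (((1 - s) ^ 2)⁻¹ * (1 - s)) = 1 := by field_simp
      rw [e1, e2]
      module
    refine h5.congr_of_eventuallyEq ?_
    filter_upwards [isOpen_Ioo.mem_nhds hs1] with r hr using hfix r (Ioo_subset_Ico_self hr)

lemma exists_path (hd : 1 ≤ d) {a : ℝ} {x : E d} (ha : 0 < a)
    (hO : Tendsto (Psi Ω p₀ p₁ a) (𝓝[>] 0) atBot) (hx : x ∈ interior Ω) :
    ∃ z, IsRectifiedPath Ω p₀ p₁ x z := by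
  obtain ⟨ρ, hρ, hxρ⟩ := exists_closedBall_subset hx
  obtain ⟨z, hc, hint, hfix⟩ := H.exists_picardStep_eq hd ha hO hρ hxρ
  have hv := H.continuousOn_velocity_comp hc hint
  have hi : IntervalIntegrable (fun s => velocity Ω p₀ p₁ s (z s)) volume 0 1 := by
    rw [intervalIntegrable_iff_integrableOn_Ioo_of_le zero_le_one]
    refine Integrable.of_bound (C := Metric.diam Ω)
      ((hv.mono Ioo_subset_Ico_self).aestronglyMeasurable measurableSet_Ioo) ?_
    filter_upwards [ae_restrict_mem measurableSet_Ioo] with s hs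
    exact H.norm_velocity_le (Ioo_subset_Icc_self hs) (hint s (Ioo_subset_Ico_self hs))
  -- The fixed point is controlled only on `[0, 1)`. Its value at time `1` is redefined by the
  -- integral equation, which does not affect the integrals.
  set y := Function.update z 1 (x + ∫ s in (0 : ℝ)..1, velocity Ω p₀ p₁ s (z s)) with hy
  have hyz : ∀ t, t ≠ 1 → y t = z t := fun t ht => Function.update_of_ne ht _ _
  have hae : ∀ᵐ s : ℝ, velocity Ω p₀ p₁ s (y s) = velocity Ω p₀ p₁ s (z s) := by
    filter_upwards [Measure.ae_ne volume (1 : ℝ)] with s hs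
    rw [hyz s hs]
  have hI : ∀ t, ∫ s in (0 : ℝ)..t, velocity Ω p₀ p₁ s (y s) =
      ∫ s in (0 : ℝ)..t, velocity Ω p₀ p₁ s (z s) := fun t =>
    intervalIntegral.integral_congr_ae (hae.mono fun s hs _ => hs)
  refine ⟨y, fun t ht => by rw [hyz t ht.2.ne]; exact hint t ht,
    hi.congr_ae (ae_restrict_of_ae (hae.mono fun s hs => hs.symm)), fun t ht => ?_⟩
  rw [hI]
  rcases ht.2.eq_or_lt with rfl | h1
  · exact Function.update_self _ _ _
  · rw [hyz t h1.ne]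
    exact H.integral_velocity_of_picardStep_eq hc hint hfix ⟨ht.1, h1⟩

end Admissible

/-! ### The rectified flow -/

lemma erosion_subset_interior {ε : ℝ} (hε : 0 < ε) : erosion Ω ε ⊆ interior Ω :=
  fun _ hx => mem_interior_of_closedBall hε hx

lemma le_diam_of_closedBall_subset (hd : 1 ≤ d) (hΩ : Bornology.IsBounded Ω) {x : E d} {ε : ℝ}
    (hε : 0 < ε) (hx : Metric.closedBall x ε ⊆ Ω) : ε ≤ Metric.diam Ω := by
  have : Nonempty (Fin d) := ⟨⟨0, hd⟩⟩
  have : Nontrivial (E d) := inferInstance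
  obtain ⟨v, hv⟩ := exists_norm_eq (E d) hε.le
  have h1 : x + v ∈ Ω := hx (by simp [hv])
  have h2 := Metric.dist_le_diam_of_mem hΩ h1 (hx (Metric.mem_closedBall_self hε.le))
  simpa [hv] using h2

/-- The ball is connected and misses the frontier, so it lies in the interior of `Ω` or in its
complement; its centre rules out the latter. -/
lemma closedBall_subset_of_lt_infDist (hΩ : IsClosed Ω) {x : E d} {γ : ℝ} (hγ : 0 ≤ γ)
    (hx : x ∈ Ω) (h : γ < Metric.infDist x (frontier Ω)) : Metric.closedBall x γ ⊆ Ω := by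
  have hdisj : ∀ y ∈ Metric.closedBall x γ, y ∉ frontier Ω := by
    intro y hy hyf
    have := Metric.infDist_le_dist_of_mem (x := x) hyf
    rw [Metric.mem_closedBall, dist_comm] at hy
    linarith
  have hcover : Metric.closedBall x γ ⊆ interior Ω ∪ Ωᶜ := by
    intro y hy
    by_cases hyΩ : y ∈ Ω
    · left
      by_contra hyi
      exact hdisj y hy ⟨subset_closure hyΩ, hyi⟩
    · exact Or.inr hyΩ
  rcases (convex_closedBall x γ).isPreconnected.subset_or_subset isOpen_interior hΩ.isOpen_compl
    (disjoint_compl_right.mono_left interior_subset) hcover with h1 | h1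
  · exact h1.trans interior_subset
  · exact absurd hx (h1 (Metric.mem_closedBall_self hγ))

namespace Admissible

variable (H : Admissible Ω p₀ p₁)
include H

lemma isRectifiedPath_rectifiedFlow (hd : 1 ≤ d) {a : ℝ} {x : E d} (ha : 0 < a)
    (hO : Tendsto (Psi Ω p₀ p₁ a) (𝓝[>] 0) atBot) (hx : x ∈ interior Ω) :
    IsRectifiedPath Ω p₀ p₁ x (fun t => rectifiedFlow Ω p₀ p₁ t x) :=
  Classical.epsilon_spec (H.exists_path hd ha hO hx)

lemma path_mem {x : E d} {z : ℝ → E d} (hz : IsRectifiedPath Ω p₀ p₁ x z) {t : ℝ}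
    (ht : t ∈ Icc (0 : ℝ) 1) : z t ∈ Ω := by
  have h1 : MapsTo z (Ico 0 1) Ω := fun s hs => interior_subset (hz.mem_interior s hs)
  have h2 : z t ∈ closure (z '' Ico 0 1) := by
    refine ((H.continuousOn_path hz) t ht).mono Ico_subset_Icc_self |>.mem_closure_image ?_
    rwa [closure_Ico zero_ne_one]
  exact closure_minimal h1.image_subset H.compact.isClosed h2

/-! ### Explicit moduli of continuity of the flow -/

/-- The uniform bound on the flow on `Ω^{-ε}`. -/
lemma norm_path_sub_path_le_globalModulus (hd : 1 ≤ d) {a η ε : ℝ} {x x' : E d}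
    {z z' : ℝ → E d} (ha : 0 < a) (hO : Tendsto (Psi Ω p₀ p₁ a) (𝓝[>] 0) atBot)
    (hz : IsRectifiedPath Ω p₀ p₁ x z) (hz' : IsRectifiedPath Ω p₀ p₁ x' z')
    (hη : 0 < η) (hxx : ‖x - x'‖ ≤ η) (hε : 0 < ε) (hx : Metric.closedBall x ε ⊆ Ω)
    (hx' : Metric.closedBall x' ε ⊆ Ω) {t : ℝ} (ht : t ∈ Icc (0 : ℝ) 1) :
    ‖z t - z' t‖ ≤ globalModulus Ω p₀ p₁ a
      (velocityConst d (Metric.diam Ω) (omegaInvOne Ω p₀ p₁))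
      (2 * velocityConst d (Metric.diam Ω) (omegaInvOne Ω p₀ p₁)) ε η := by
  set A := velocityConst d (Metric.diam Ω) (omegaInvOne Ω p₀ p₁) with hAdef
  have hA : 0 < A := velocityConst_pos _ _ _
  have hD := H.diam_pos hd
  have hlog : 0 ≤ Real.log (Metric.diam Ω / ε) := Real.log_nonneg
    ((one_le_div hε).2 (le_diam_of_closedBall_subset hd H.compact.isBounded hε hx))
  rw [globalModulus, if_neg hη.ne']
  set y := Psi Ω p₀ p₁ a η with hy
  set r := PsiInv Ω p₀ p₁ a
    (y / 2 + A + 2 * A / ε * Real.log (Metric.diam Ω / ε)) with hr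
  set q := PsiInv Ω p₀ p₁ a (-2 * (2 * A) / ε) with hq
  have hr0 : 0 < r := H.PsiInv_pos ha hO _
  have hq0 : 0 < q := H.PsiInv_pos ha hO _
  have hΨr : Psi Ω p₀ p₁ a r = y / 2 + A + 2 * A / ε * Real.log (Metric.diam Ω / ε) :=
    H.Psi_PsiInv ha hO _
  have hΨq : Psi Ω p₀ p₁ a q = -2 * (2 * A) / ε := H.Psi_PsiInv ha hO _
  -- If `η ≥ q`, the second entry of the maximum is at least `1` and `diam Ω` alone bounds the
  -- left-hand side. Otherwise `ε Ψ(η) ≤ -4 A`, which makes the choice of `τ` below legitimate.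
  rcases le_or_gt q η with hqη | hηq
  · have h1 : ‖z t - z' t‖ ≤ Metric.diam Ω := by
      rw [← dist_eq_norm]
      exact Metric.dist_le_diam_of_mem H.compact.isBounded (H.path_mem hz ht) (H.path_mem hz' ht)
    have h2 : 1 ≤ max (4 * (2 * A) / (2 * (2 * A) - ε * y)) (η / q) :=
      ((one_le_div hq0).2 hqη).trans (le_max_right _ _)
    have h3 := le_mul_of_one_le_right hD.le h2
    linarith
  · have hyq : y ≤ -2 * (2 * A) / ε := by
      rw [← hΨq]
      exact ((H.strictMonoOn_Psi ha).le_iff_le hη hq0).2 hηq.le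
    have hεy : ε * y ≤ -(4 * A) := by
      rw [le_div_iff₀ hε] at hyq
      linarith
    have hden : 0 < 4 * A - ε * y := by linarith
    -- With `C₂ = 2 A` this turns `2 diam(Ω) τ` into `diam(Ω)` times the first entry of the maximum.
    -- The Osgood cost is `A / (τ ε) = (4 A - ε y) / (4 ε) ≤ -y / 2`, so half of `Ψ(η)` is left.
    set τ := 4 * A / (4 * A - ε * y) with hτ
    have hτ0 : 0 < τ := by positivity
    have hτ2 : τ ≤ 1 / 2 := by
      rw [hτ, div_le_iff₀ hden]
      linarith
    have hcost : y + A * (1 + 1 / (τ * ε)) ≤ Psi Ω p₀ p₁ a r := by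
      rw [hΨr]
      have e1 : A * (1 / (τ * ε)) = (4 * A - ε * y) / (4 * ε) := by
        rw [hτ]
        field_simp
      have e2 : (4 * A - ε * y) / (4 * ε) ≤ -y / 2 := by
        rw [div_le_iff₀ (by positivity)]
        linarith
      have e3 : 0 ≤ 2 * A / ε * Real.log (Metric.diam Ω / ε) := by positivity
      rw [mul_add, e1]
      linarith
    have key := H.norm_path_sub_path_le_add hd ha hz hz' hη hxx hε hx hx' hτ0 (by linarith)
      hr0 hcost t ht
    have e4 : 2 * Metric.diam Ω * τ =
        Metric.diam Ω * (4 * (2 * A) / (2 * (2 * A) - ε * y)) := by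
      rw [hτ, show 2 * (2 * A) - ε * y = 4 * A - ε * y by ring]
      ring
    rw [e4] at key
    refine key.trans (add_le_add_right (mul_le_mul_of_nonneg_left (le_max_left _ _) hD.le) _)

/-- A path that ends at a distance `γ` from the boundary keeps the distance `γ ε / (2 diam Ω)`. -/
lemma closedBall_path_subset_of_end (hd : 1 ≤ d) {ε γ : ℝ} {x : E d} {z : ℝ → E d}
    (hz : IsRectifiedPath Ω p₀ p₁ x z) (hε : 0 < ε) (hx : Metric.closedBall x ε ⊆ Ω) (hγ : 0 < γ)
    (h1 : Metric.closedBall (z 1) γ ⊆ Ω) {t : ℝ} (ht : t ∈ Ico (0 : ℝ) 1) :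
    Metric.closedBall (z t) (γ * ε / (2 * Metric.diam Ω)) ⊆ Ω := by
  have hD := H.diam_pos hd
  have hεD := le_diam_of_closedBall_subset hd H.compact.isBounded hε hx
  -- Early on, the distance `(1 - t) ε` suffices. Late, the remaining motion is at most `γ / 2`, and
  -- the claimed radius is at most `γ / 2` because `ε ≤ diam Ω`.
  rcases le_total (γ / (2 * Metric.diam Ω)) (1 - t) with h | h
  · refine (Metric.closedBall_subset_closedBall ?_).trans (H.closedBall_path_subset hz hx ht)
    calc γ * ε / (2 * Metric.diam Ω) = γ / (2 * Metric.diam Ω) * ε := by ring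
      _ ≤ (1 - t) * ε := by gcongr
  · refine (Metric.closedBall_subset_closedBall' ?_).trans h1
    have h2 := H.norm_path_sub_le hz (right_mem_Icc.2 zero_le_one) ⟨ht.1, ht.2.le⟩
    rw [← dist_eq_norm, abs_sub_comm, abs_of_nonneg (sub_nonneg.2 ht.2.le)] at h2
    have h3 : Metric.diam Ω * (1 - t) ≤ γ / 2 := by
      calc _ ≤ Metric.diam Ω * (γ / (2 * Metric.diam Ω)) := by gcongr
        _ = γ / 2 := by field_simp
    have h4 : γ * ε / (2 * Metric.diam Ω) ≤ γ / 2 := by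
      rw [div_le_iff₀ (by positivity)]
      nlinarith
    linarith

/-- The bound on the flow on `Ω^{-ε} \ 𝒜_γ`. -/
lemma norm_path_sub_path_le_away (hd : 1 ≤ d) {a η ε γ K₂ K₃ : ℝ} {x x' : E d}
    {z z' : ℝ → E d} (ha : 0 < a) (hO : Tendsto (Psi Ω p₀ p₁ a) (𝓝[>] 0) atBot)
    (hz : IsRectifiedPath Ω p₀ p₁ x z) (hz' : IsRectifiedPath Ω p₀ p₁ x' z')
    (hη : 0 < η) (hxx : ‖x - x'‖ ≤ η) (hε : 0 < ε) (hx : Metric.closedBall x ε ⊆ Ω)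
    (hx' : Metric.closedBall x' ε ⊆ Ω) (hγ : 0 < γ) (h1 : Metric.closedBall (z 1) γ ⊆ Ω)
    (h1' : Metric.closedBall (z' 1) γ ⊆ Ω) (hK₂ : 0 < K₂)
    (hK₃ : 2 * Metric.diam Ω * velocityConst d (Metric.diam Ω) (omegaInvOne Ω p₀ p₁) ≤ K₃)
    {t : ℝ} (ht : t ∈ Icc (0 : ℝ) 1) :
    ‖z t - z' t‖ ≤ PsiInv Ω p₀ p₁ a (Psi Ω p₀ p₁ a η +
      awayExponent Ω (velocityConst d (Metric.diam Ω) (omegaInvOne Ω p₀ p₁)) K₂ K₃ ε γ) := by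
  have hD := H.diam_pos hd
  have hlog : 0 ≤ Real.log (Metric.diam Ω / ε) := Real.log_nonneg
    ((one_le_div hε).2 (le_diam_of_closedBall_subset hd H.compact.isBounded hε hx))
  refine H.norm_path_sub_path_le hd ha hz hz' hη hxx
    (ρ := γ * ε / (2 * Metric.diam Ω)) (by positivity) le_rfl
    (fun t ht => H.closedBall_path_subset_of_end hd hz hε hx hγ h1 ht)
    (fun t ht => H.closedBall_path_subset_of_end hd hz' hε hx' hγ h1' ht)
    (H.PsiInv_pos ha hO _) ?_ t ht
  -- For `ρ = γ ε / (2 diam Ω)` the cost `A / ρ` is `2 diam(Ω) A / (ε γ)`, which is absorbed by the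
  -- `K₃` term; the logarithmic term only has to be nonnegative.
  rw [H.Psi_PsiInv ha hO, awayExponent]
  set A := velocityConst d (Metric.diam Ω) (omegaInvOne Ω p₀ p₁)
  have e1 : A * (1 + 1 / (γ * ε / (2 * Metric.diam Ω))) =
      A + 2 * Metric.diam Ω * A / (ε * γ) := by
    field_simp
  have e2 : 0 ≤ K₂ / min ε γ * Real.log (Metric.diam Ω / ε) := by
    have := lt_min hε hγ
    positivity
  have e3 : 2 * Metric.diam Ω * A / (ε * γ) ≤ K₃ / (ε * γ) := by gcongr
  rw [e1]
  linarith

/-- If `ω` is bounded linearly then so is the modulus of continuity. -/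
lemma PsiInv_le_exp_mul {a L Q η : ℝ} (ha : 0 < a)
    (hO : Tendsto (Psi Ω p₀ p₁ a) (𝓝[>] 0) atBot) (hη : 0 < η) (hL : 0 ≤ L) (hQ : 0 ≤ Q)
    (h : ∀ s, 0 ≤ s → omega Ω p₀ p₁ s ≤ L * s) :
    PsiInv Ω p₀ p₁ a (Psi Ω p₀ p₁ a η + Q) ≤ Real.exp ((1 + L) * Q) * η := by
  set r := PsiInv Ω p₀ p₁ a (Psi Ω p₀ p₁ a η + Q)
  have hr0 : 0 < r := H.PsiInv_pos ha hO _
  have hr : Psi Ω p₀ p₁ a r = Psi Ω p₀ p₁ a η + Q := H.Psi_PsiInv ha hO _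
  have hηr : η ≤ r := ((H.strictMonoOn_Psi ha).le_iff_le hη hr0).1 (by linarith)
  have h1 := H.log_div_le_Psi_sub (L := 1 + L) ha hη hηr fun s hs => by
    linarith [h s (hη.le.trans hs.1)]
  rw [hr, add_sub_cancel_left, div_le_iff₀ (by positivity), Real.log_le_iff_le_exp (by positivity),
    div_le_iff₀ hη, mul_comm Q] at h1
  exact h1

omit H in
lemma abs_div_sub_one_le_of_lipschitz {p : E d → ℝ} {K : NNReal} {c : ℝ} (hc : 0 < c)
    (hpc : ∀ x ∈ Ω, c ≤ p x) (hp : LipschitzOnWith K p Ω) {x y : E d} (hx : x ∈ Ω) (hy : y ∈ Ω) :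
    |p x / p y - 1| ≤ K / c * ‖x - y‖ := by
  have hy0 := hc.trans_le (hpc y hy)
  have h1 := hp.dist_le_mul x hx y hy
  rw [Real.dist_eq, dist_eq_norm] at h1
  rw [div_sub_one hy0.ne', abs_div, abs_of_pos hy0, div_le_iff₀ hy0]
  calc |p x - p y| ≤ K * ‖x - y‖ := h1
    _ = K / c * ‖x - y‖ * c := by field_simp
    _ ≤ K / c * ‖x - y‖ * p y := by
      gcongr
      exact hpc y hy

lemma exists_omega_le_mul {K : NNReal} (h₀ : LipschitzOnWith K p₀ Ω)
    (h₁ : LipschitzOnWith K p₁ Ω) :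
    ∃ L : ℝ, 0 ≤ L ∧ ∀ η : ℝ, 0 ≤ η → omega Ω p₀ p₁ η ≤ L * η := by
  obtain ⟨c₀, hc₀, hp₀⟩ := H.left.bounded_below
  obtain ⟨c₁, hc₁, hp₁⟩ := H.right.bounded_below
  refine ⟨max (K / c₀) (K / c₁), by positivity, fun η hη => omega_le (by positivity) ?_⟩
  intro x hx y hy hxy
  refine max_le ((abs_div_sub_one_le_of_lipschitz hc₀ hp₀ h₀ hx hy).trans ?_)
    ((abs_div_sub_one_le_of_lipschitz hc₁ hp₁ h₁ hx hy).trans ?_)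
  · gcongr
    exact le_max_left _ _
  · gcongr
    exact le_max_right _ _

lemma closedBall_rectifiedFlow_subset (hd : 1 ≤ d) {a ε γ : ℝ} {x : E d} (ha : 0 < a)
    (hO : Tendsto (Psi Ω p₀ p₁ a) (𝓝[>] 0) atBot) (hε : 0 < ε) (hγ : 0 < γ)
    (hx : x ∈ erosion Ω ε \ nearBoundary Ω p₀ p₁ γ) :
    Metric.closedBall (rectifiedFlow Ω p₀ p₁ 1 x) γ ⊆ Ω := by
  have hxi := erosion_subset_interior hε hx.1
  refine closedBall_subset_of_lt_infDist H.compact.isClosed hγ.le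
    (H.path_mem (H.isRectifiedPath_rectifiedFlow hd ha hO hxi) (right_mem_Icc.2 zero_le_one)) ?_
  by_contra h
  exact hx.2 ⟨interior_subset hxi, not_lt.1 h⟩

end Admissible

end RectifiedFlow

end

/-- Fixing `D` and `w` before `Ω` and the densities expresses that the constants depend only on `d`,
`diam Ω` and `ω⁻¹(1)`. Under Osgood's condition every antiderivative has exactly one zero `a > 0`,
so varying `a` covers all of them. -/
theorem mainTheorem8 (d : ℕ) (hd : 1 ≤ d) (D w : ℝ) :
    ∃ C₁ C₂ K₁ K₂ K₃ : ℝ, 0 < C₁ ∧ 0 < C₂ ∧ 0 < K₁ ∧ 0 < K₂ ∧ 0 < K₃ ∧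
      ∀ (Ω : Set (RectifiedFlow.E d)) (p₀ p₁ : RectifiedFlow.E d → ℝ) (a : ℝ),
        IsCompact Ω → Convex ℝ Ω → (interior Ω).Nonempty →
        RectifiedFlow.IsRegularDensity Ω p₀ → RectifiedFlow.IsRegularDensity Ω p₁ →
        0 < a →
        Tendsto (RectifiedFlow.Psi Ω p₀ p₁ a) (𝓝[>] 0) atBot →
        Metric.diam Ω = D → RectifiedFlow.omegaInvOne Ω p₀ p₁ = w →
        -- the flow is the unique solution of the integral equation
        (∀ x ∈ interior Ω,
          RectifiedFlow.IsRectifiedPath Ω p₀ p₁ x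
            (fun t => RectifiedFlow.rectifiedFlow Ω p₀ p₁ t x) ∧
          ∀ z : ℝ → RectifiedFlow.E d, RectifiedFlow.IsRectifiedPath Ω p₀ p₁ x z →
            ∀ t ∈ Icc (0 : ℝ) 1, z t = RectifiedFlow.rectifiedFlow Ω p₀ p₁ t x) ∧
        ∀ ε : ℝ, 0 < ε →
          -- uniform continuity on `Ω^{-ε}`, uniformly in `t`
          UniformEquicontinuousOn
            (fun (t : Icc (0 : ℝ) 1) (x : RectifiedFlow.E d) =>
              RectifiedFlow.rectifiedFlow Ω p₀ p₁ t x)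
            (RectifiedFlow.erosion Ω ε) ∧
          -- the explicit modulus on `Ω^{-ε}`
          (∀ η : ℝ, 0 ≤ η → ∀ t ∈ Icc (0 : ℝ) 1,
            ∀ x ∈ RectifiedFlow.erosion Ω ε, ∀ x' ∈ RectifiedFlow.erosion Ω ε, ‖x - x'‖ ≤ η →
              ‖RectifiedFlow.rectifiedFlow Ω p₀ p₁ t x -
                  RectifiedFlow.rectifiedFlow Ω p₀ p₁ t x'‖ ≤
                RectifiedFlow.globalModulus Ω p₀ p₁ a C₁ C₂ ε η) ∧
          -- the sharper modulus away from `𝒜_γ`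
          ∀ γ : ℝ, 0 < γ → γ ≤ Metric.diam Ω / 2 →
            (∀ η : ℝ, 0 ≤ η → ∀ t ∈ Icc (0 : ℝ) 1,
              ∀ x ∈ RectifiedFlow.erosion Ω ε \ RectifiedFlow.nearBoundary Ω p₀ p₁ γ,
              ∀ x' ∈ RectifiedFlow.erosion Ω ε \ RectifiedFlow.nearBoundary Ω p₀ p₁ γ,
                ‖x - x'‖ ≤ η →
                ‖RectifiedFlow.rectifiedFlow Ω p₀ p₁ t x -
                    RectifiedFlow.rectifiedFlow Ω p₀ p₁ t x'‖ ≤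
                  RectifiedFlow.awayModulus Ω p₀ p₁ a K₁ K₂ K₃ ε γ η) ∧
            -- which is a Lipschitz bound when `ω` is linearly bounded
            (∀ L : ℝ, 0 ≤ L → (∀ η : ℝ, 0 ≤ η → RectifiedFlow.omega Ω p₀ p₁ η ≤ L * η) →
              ∀ t ∈ Icc (0 : ℝ) 1,
              ∀ x ∈ RectifiedFlow.erosion Ω ε \ RectifiedFlow.nearBoundary Ω p₀ p₁ γ,
              ∀ x' ∈ RectifiedFlow.erosion Ω ε \ RectifiedFlow.nearBoundary Ω p₀ p₁ γ,
                ‖RectifiedFlow.rectifiedFlow Ω p₀ p₁ t x -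
                    RectifiedFlow.rectifiedFlow Ω p₀ p₁ t x'‖ ≤
                  Real.exp ((1 + L) * RectifiedFlow.awayExponent Ω K₁ K₂ K₃ ε γ) *
                    ‖x - x'‖) ∧
            -- in particular when the densities are Lipschitz
            ((∃ K : NNReal, LipschitzOnWith K p₀ Ω ∧ LipschitzOnWith K p₁ Ω) →
              ∃ M : NNReal, ∀ t ∈ Icc (0 : ℝ) 1,
                LipschitzOnWith M (RectifiedFlow.rectifiedFlow Ω p₀ p₁ t)
                  (RectifiedFlow.erosion Ω ε \ RectifiedFlow.nearBoundary Ω p₀ p₁ γ)) := by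
  set A := RectifiedFlow.velocityConst d D w with hAdef
  have hA : 0 < A := RectifiedFlow.velocityConst_pos d D w
  -- Here `D` is still an arbitrary real, so `|D|` and the summand `1` secure positivity. The value
  -- `1` for `K₂` is arbitrary.
  refine ⟨A, 2 * A, A, 1, 2 * |D| * A + 1, hA, by positivity, hA, one_pos, by positivity, ?_⟩
  intro Ω p₀ p₁ a hcomp hconv hne hp₀ hp₁ ha hO hD hw
  have H : RectifiedFlow.Admissible Ω p₀ p₁ := ⟨hcomp, hconv, hne, hp₀, hp₁⟩
  subst hD hw
  have hdiam := H.diam_pos hd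
  have hpath : ∀ x ∈ interior Ω, RectifiedFlow.IsRectifiedPath Ω p₀ p₁ x
      (fun t => RectifiedFlow.rectifiedFlow Ω p₀ p₁ t x) := fun x hx =>
    H.isRectifiedPath_rectifiedFlow hd ha hO hx
  refine ⟨fun x hx => ⟨hpath x hx, fun z hz =>
    H.path_unique hd ha hO hx hz (hpath x hx)⟩, fun ε hε => ?_⟩
  have hint := RectifiedFlow.erosion_subset_interior (Ω := Ω) hε
  refine ⟨?_, ?_, fun γ hγ _ => ?_⟩
  -- Equicontinuity follows directly from Osgood's condition, without showing that the explicit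
  -- modulus tends to zero.
  · intro U hU
    obtain ⟨r, hr, hrU⟩ := Metric.mem_uniformity_dist.1 hU
    obtain ⟨η, hη, h⟩ := H.exists_norm_path_sub_path_le hd ha hO hε (half_pos hr)
    rw [eventually_inf_principal]
    filter_upwards [Metric.dist_mem_uniformity hη] with q hq hqS t
    obtain ⟨hx, hx'⟩ := hqS
    have hxx : ‖q.1 - q.2‖ < η := by rw [← dist_eq_norm]; exact hq
    refine hrU ?_
    rw [dist_eq_norm]
    exact (h q.1 q.2 _ _ (hpath _ (hint hx)) (hpath _ (hint hx')) hx hx' hxx.le t t.2).trans_lt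
      (half_lt_self hr)
  · intro η hη t ht x hx x' hx' hxx
    rcases hη.eq_or_lt with rfl | hη
    · obtain rfl : x = x' := by simpa [sub_eq_zero] using hxx
      simp [RectifiedFlow.globalModulus]
    · exact H.norm_path_sub_path_le_globalModulus hd ha hO (hpath x (hint hx))
        (hpath x' (hint hx')) hη hxx hε hx hx' ht
  · have hK₃ : 2 * Metric.diam Ω * A ≤ 2 * |Metric.diam Ω| * A + 1 := by
      rw [abs_of_pos hdiam]
      linarith
    have haway : ∀ η, 0 < η → ∀ t ∈ Icc (0 : ℝ) 1,
        ∀ x ∈ RectifiedFlow.erosion Ω ε \ RectifiedFlow.nearBoundary Ω p₀ p₁ γ,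
        ∀ x' ∈ RectifiedFlow.erosion Ω ε \ RectifiedFlow.nearBoundary Ω p₀ p₁ γ, ‖x - x'‖ ≤ η →
        ‖RectifiedFlow.rectifiedFlow Ω p₀ p₁ t x - RectifiedFlow.rectifiedFlow Ω p₀ p₁ t x'‖ ≤
          RectifiedFlow.PsiInv Ω p₀ p₁ a (RectifiedFlow.Psi Ω p₀ p₁ a η +
            RectifiedFlow.awayExponent Ω A 1 (2 * |Metric.diam Ω| * A + 1) ε γ) :=
      fun η hη t ht x hx x' hx' hxx =>
        H.norm_path_sub_path_le_away hd ha hO (hpath x (hint hx.1)) (hpath x' (hint hx'.1)) hη hxx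
          hε hx.1 hx'.1 hγ (H.closedBall_rectifiedFlow_subset hd ha hO hε hγ hx)
          (H.closedBall_rectifiedFlow_subset hd ha hO hε hγ hx') one_pos hK₃ ht
    have hlip : ∀ L : ℝ, 0 ≤ L → (∀ η : ℝ, 0 ≤ η → RectifiedFlow.omega Ω p₀ p₁ η ≤ L * η) →
        ∀ t ∈ Icc (0 : ℝ) 1,
        ∀ x ∈ RectifiedFlow.erosion Ω ε \ RectifiedFlow.nearBoundary Ω p₀ p₁ γ,
        ∀ x' ∈ RectifiedFlow.erosion Ω ε \ RectifiedFlow.nearBoundary Ω p₀ p₁ γ,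
        ‖RectifiedFlow.rectifiedFlow Ω p₀ p₁ t x - RectifiedFlow.rectifiedFlow Ω p₀ p₁ t x'‖ ≤
          Real.exp ((1 + L) *
            RectifiedFlow.awayExponent Ω A 1 (2 * |Metric.diam Ω| * A + 1) ε γ) * ‖x - x'‖ := by
      intro L hL hω t ht x hx x' hx'
      rcases eq_or_ne x x' with rfl | hne
      · simp
      have hη : 0 < ‖x - x'‖ := norm_pos_iff.2 (sub_ne_zero.2 hne)
      -- The Lipschitz bound is the modulus at `η = ‖x - x'‖`.
      refine (haway _ hη t ht x hx x' hx' le_rfl).trans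
        (H.PsiInv_le_exp_mul ha hO hη hL ?_ hω)
      have hlog : 0 ≤ Real.log (Metric.diam Ω / ε) := Real.log_nonneg ((one_le_div hε).2
        (RectifiedFlow.le_diam_of_closedBall_subset hd hcomp.isBounded hε hx.1))
      have := lt_min hε hγ
      unfold RectifiedFlow.awayExponent
      positivity
    refine ⟨?_, hlip, ?_⟩
    · intro η hη t ht x hx x' hx' hxx
      rcases hη.eq_or_lt with rfl | hη
      · obtain rfl : x = x' := by simpa [sub_eq_zero] using hxx
        simp [RectifiedFlow.awayModulus]
      · rw [RectifiedFlow.awayModulus, if_neg hη.ne']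
        exact haway η hη t ht x hx x' hx' hxx
    · rintro ⟨K, h₀, h₁⟩
      obtain ⟨L, hL, hω⟩ := H.exists_omega_le_mul h₀ h₁
      refine ⟨⟨Real.exp ((1 + L) *
        RectifiedFlow.awayExponent Ω A 1 (2 * |Metric.diam Ω| * A + 1) ε γ),
        (Real.exp_pos _).le⟩, fun t ht => LipschitzOnWith.of_dist_le_mul
        fun x hx x' hx' => ?_⟩
      rw [dist_eq_norm, dist_eq_norm]
      exact hlip L hL hω t ht x hx x' hx'
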